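/- Let $1\le N\le 4$, let $\Omega\subset\mathbb{R}^N$ be a bounded domain (nonempty, open, connected), and let $m\in\mathbb N$ and $\varepsilon_1,\dots,\varepsilon_m>0$. Let $H=H_0^1(\Omega,\mathbb{R}^m)$, i.e. each component lies in the closure of $C_c^\infty(\Omega)$ in $H^1(\Omega)$, and put $$\|\mathbf u\|_H=\Big(\int_\Omega\sum_{i=1}^m\varepsilon_i|\nabla u_i|^2\,dx\Big)^{1/2}.$$ Let $\lambda_1=\inf\{\int_\Omega|\nabla u|^2dx: u\in H_0^1(\Omega),\ \int_\Omega u^2dx=1\}$ be the first Dirichlet eigenvalue of $-\Delta$ in $\Omega$. Let $g=(g_{ij})\in\mathbb{R}^{m\times m}$ be symmetric and assume that either $g_{ij}>0$ for all $i,j$, or $g$ is positive definite. Let $a_1,\dots,a_m\in L^\infty(\Omega)$ satisfy $a_i(x)>-\varepsilon_i\lambda_1$ for a.e. $x\in\Omega$ and all $i$. Define, for $\mathbf u\in H$, $$K(\mathbf u)=\int_\Omega\sum_{i=1}^m\big(\varepsilon_i|\nabla u_i|^2+a_iu_i^2\big)dx,\qquad I(\mathbf u)=\int_\Omega\sum_{i,j=1}^m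 g_{ij}u_i^2u_j^2\,dx,\qquad E(\mathbf u)=\tfrac12K(\mathbf u)-\tfrac14I(\mathbf u),$$ let $\mathcal N=\{\mathbf u\in H\setminus\{0\}:\langle E'(\mathbf u),\mathbf u\rangle=0\}$ be the Nehari manifold, where $E'$ is the Fréchet derivative of $E$, and for $\mathbf v\in H\setminus\{0\}$ let $\rho(\mathbf v)=(K(\mathbf v)/I(\mathbf v))^{1/2}$. For $\mathbf u,\bar{\mathbf u}\in\mathcal N$ and $t\in[0,1]$ put $\hat{\mathbf w}=\mathbf u+t(\mathbf u-\bar{\mathbf u})$. Then: (i) $\hat{\mathbf w}\neq0$, and $\mathbf w:=\rho(\hat{\mathbf w})\hat{\mathbf w}$ lies in $\mathcal N$; (ii) $\operatorname{dist}(\hat{\mathbf w},\mathcal N):=\inf_{\tilde{\mathbf w}\in\mathcal N}\|\hat{\mathbf w}-\tilde{\mathbf w}\|_H\le\|\mathbf w-\hat{\mathbf w}\|_H$, and $\|\mathbf w-\hat{\mathbf w}\|_H=o(\|\mathbf u-\bar{\mathbf u}\|_H)$ as $\|\mathbf u-\bar{\mathbf u}\|_H\to0$, uniformly on $\mathcal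 N$ and in $t$: for every $\eta>0$ there is $\delta>0$ such that for all $\mathbf u,\bar{\mathbf u}\in\mathcal N$ with $\|\mathbf u-\bar{\mathbf u}\|_H<\delta$ and all $t\in[0,1]$, $\|\mathbf w-\hat{\mathbf w}\|_H\le\eta\,\|\mathbf u-\bar{\mathbf u}\|_H$. -/

import Mathlib

open MeasureTheory Set Filter Topology
open scoped ContDiff ENNReal

noncomputable section

namespace Nehari

/-- The Euclidean space `ℝ^d`. -/
abbrev Rn (d : ℕ) : Type := EuclideanSpace ℝ (Fin d)

/-- The space `L²(Ω) × L²(Ω, ℝ^d)`, in which a Sobolev function `u` is represented by its graph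
`(u, ∇u)`; its norm induces the topology of the `H¹`-norm on such graphs. -/
abbrev GraphSpace {d : ℕ} (Ω : Set (Rn d)) : Type :=
  Lp ℝ 2 (volume.restrict Ω) × Lp (Rn d) 2 (volume.restrict Ω)

/-- `φ ∈ C_c^∞(Ω)`: smooth functions with compact support contained in `Ω`. -/
def IsTestFunction {d : ℕ} (Ω : Set (Rn d)) (φ : Rn d → ℝ) : Prop :=
  ContDiff ℝ ∞ φ ∧ HasCompactSupport φ ∧ tsupport φ ⊆ Ω

/-- The subspace `{(φ, ∇φ) : φ ∈ C_c^∞(Ω)}`. -/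
def testGraphs {d : ℕ} (Ω : Set (Rn d)) : Submodule ℝ (GraphSpace Ω) where
  carrier := {p | ∃ φ : Rn d → ℝ, IsTestFunction Ω φ ∧
    p.1 =ᵐ[volume.restrict Ω] φ ∧ p.2 =ᵐ[volume.restrict Ω] gradient φ}
  zero_mem' := by
    refine ⟨fun _ => 0, ⟨contDiff_const, HasCompactSupport.zero, ?_⟩, ?_, ?_⟩
    · simp [tsupport]
    · exact Lp.coeFn_zero _ _ _
    · have h : gradient (fun _ : Rn d => (0 : ℝ)) = 0 := by
        funext x; simp [gradient]
      rw [h]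
      exact Lp.coeFn_zero _ _ _
  add_mem' := by
    rintro p q ⟨φ, ⟨h1, h2, h3⟩, h4, h5⟩ ⟨ψ, ⟨k1, k2, k3⟩, k4, k5⟩
    refine ⟨φ + ψ, ⟨h1.add k1, h2.add k2, ?_⟩, ?_, ?_⟩
    · exact (tsupport_add φ ψ).trans (union_subset h3 k3)
    · exact (Lp.coeFn_add p.1 q.1).trans (h4.add k4)
    · have h : gradient (φ + ψ) = gradient φ + gradient ψ := by
        funext x
        simp only [gradient, Pi.add_apply]
        rw [fderiv_add (h1.differentiable (by simp) x) (k1.differentiable (by simp) x), map_add]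
      rw [h]
      exact (Lp.coeFn_add p.2 q.2).trans (h5.add k5)
  smul_mem' := by
    rintro c p ⟨φ, ⟨h1, h2, h3⟩, h4, h5⟩
    refine ⟨c • φ, ⟨contDiff_const.smul h1, h2.smul_left, ?_⟩, ?_, ?_⟩
    · exact (closure_mono (Function.support_const_smul_subset c φ)).trans h3
    · exact (Lp.coeFn_smul c p.1).trans (h4.const_smul c)
    · have h : gradient (c • φ) = c • gradient φ := by
        funext x
        simp only [gradient, Pi.smul_apply]
        rw [fderiv_const_smul (h1.differentiable (by simp) x), map_smulₛₗ]
        simp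
      rw [h]
      exact (Lp.coeFn_smul c p.2).trans (h5.const_smul c)

/-- The Sobolev space `H_0^1(Ω)`: the closure of `C_c^∞(Ω)` in the `H¹`-norm. An element is the
pair of a function `u` and its weak gradient `∇u` (the latter is determined by the former). -/
def H01 {d : ℕ} (Ω : Set (Rn d)) : Submodule ℝ (GraphSpace Ω) :=
  (testGraphs Ω).topologicalClosure

/-- The function `u` underlying an element of `H_0^1(Ω)`. -/
def val {d : ℕ} {Ω : Set (Rn d)} (u : H01 Ω) : Rn d → ℝ := u.1.1

/-- The weak gradient `∇u` of an element of `H_0^1(Ω)`. -/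
def grad {d : ℕ} {Ω : Set (Rn d)} (u : H01 Ω) : Rn d → Rn d := u.1.2

/-- `H = H_0^1(Ω, ℝ^m)`. As a normed space it carries the maximum of the `H¹`-norms of the
components, which is equivalent to the norm `hNorm` below; Fréchet derivatives are therefore
the same for both. -/
abbrev HSpace {d : ℕ} (Ω : Set (Rn d)) (m : ℕ) : Type := Fin m → H01 Ω

/-- `‖u‖_H = (∫_Ω ∑ᵢ εᵢ |∇uᵢ|²)^{1/2}`. -/
def hNorm {d m : ℕ} {Ω : Set (Rn d)} (ε : Fin m → ℝ) (u : HSpace Ω m) : ℝ :=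
  Real.sqrt (∫ x in Ω, ∑ i, ε i * ‖grad (u i) x‖ ^ 2)

/-- The first Dirichlet eigenvalue of `-Δ` in `Ω`,
`λ₁ = inf {∫_Ω |∇u|² : u ∈ H_0^1(Ω), ∫_Ω u² = 1}`. -/
def lambda1 {d : ℕ} (Ω : Set (Rn d)) : ℝ :=
  sInf {r | ∃ u : H01 Ω, ∫ x in Ω, val u x ^ 2 = 1 ∧ r = ∫ x in Ω, ‖grad u x‖ ^ 2}

/-- `K(u) = ∫_Ω ∑ᵢ (εᵢ |∇uᵢ|² + aᵢ uᵢ²)`. -/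
def K {d m : ℕ} {Ω : Set (Rn d)} (ε : Fin m → ℝ) (a : Fin m → Rn d → ℝ) (u : HSpace Ω m) : ℝ :=
  ∫ x in Ω, ∑ i, (ε i * ‖grad (u i) x‖ ^ 2 + a i x * val (u i) x ^ 2)

/-- `I(u) = ∫_Ω ∑ᵢⱼ gᵢⱼ uᵢ² uⱼ²`. -/
def I {d m : ℕ} {Ω : Set (Rn d)} (g : Matrix (Fin m) (Fin m) ℝ) (u : HSpace Ω m) : ℝ :=
  ∫ x in Ω, ∑ i, ∑ j, g i j * val (u i) x ^ 2 * val (u j) x ^ 2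

/-- The variational functional `E = K / 2 - I / 4`. -/
def E {d m : ℕ} {Ω : Set (Rn d)} (ε : Fin m → ℝ) (a : Fin m → Rn d → ℝ)
    (g : Matrix (Fin m) (Fin m) ℝ) (u : HSpace Ω m) : ℝ :=
  1 / 2 * K ε a u - 1 / 4 * I g u

/-- The Nehari manifold `{u ∈ H \ {0} : ⟨E'(u), u⟩ = 0}`, with `E'` the Fréchet derivative. -/
def nehari {d m : ℕ} (Ω : Set (Rn d)) (ε : Fin m → ℝ) (a : Fin m → Rn d → ℝ)
    (g : Matrix (Fin m) (Fin m) ℝ) : Set (HSpace Ω m) :=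
  {u | u ≠ 0 ∧ fderiv ℝ (E ε a g) u u = 0}

/-- `ρ(v) = (K(v) / I(v))^{1/2}`. -/
def rho {d m : ℕ} {Ω : Set (Rn d)} (ε : Fin m → ℝ) (a : Fin m → Rn d → ℝ)
    (g : Matrix (Fin m) (Fin m) ℝ) (v : HSpace Ω m) : ℝ :=
  Real.sqrt (K ε a v / I g v)

/-- `dist(v, S) = inf {‖v - s‖_H : s ∈ S}`. -/
def hDist {d m : ℕ} {Ω : Set (Rn d)} (ε : Fin m → ℝ) (v : HSpace Ω m)
    (S : Set (HSpace Ω m)) : ℝ :=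
  sInf ((fun s => hNorm ε (v - s)) '' S)

end Nehari

end

/-! ### The Sobolev inequality `‖φ‖₄ ≤ C ‖∇φ‖₂` for test functions. -/

noncomputable section

namespace Nehari

open scoped NNReal

variable {d : ℕ} {Ω : Set (Rn d)}

/-! On nonzero vectors the Nehari condition is `K = I`, with `K` quadratic and `I` quartic. Put `v =
u - ū`. Then `s ↦ (K - I)(u + s v)` is a polynomial of degree at most four that vanishes at `s = 0`
and at `s = -1`, since `u` and `u - v = ū` both lie on the manifold. Its linear coefficient, the
only one of first order in `v`, is therefore a combination of the coefficients of `s²`, `s³`, `s⁴`,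
and the defect `K - I` at `ŵ` is of second order in `v` (`abs_quartic_le`, `abs_defect_le`). Since
`ρ² - 1 = (K - I) / I` and `‖w - ŵ‖ = |ρ - 1| ‖ŵ‖`, the distance is in fact `O(‖v‖²)`.

The manifold may be unbounded, so uniformity needs care. Let `X` be the `H`-norm and `N` the
`L⁴`-norm. The estimates `N ≤ S X`, `κ X² ≤ K ≤ Λ X²` and `c N⁴ ≤ I ≤ M N⁴` imply on the manifold
that `N` is bounded below and that `X` is at most a multiple of `N²`. With these two facts all
powers of `N u` cancel in `exists_quadratic_bound`.

The analytic input is the embedding of `H_0^1` into `L⁴` (`exists_toL4`), which needs dimension at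
most four, and the coercivity of `K` (`exists_coercive`). The gap `a + ε λ₁ > 0` is only pointwise;
it is made quantitative by truncating the weight and using `L⁴`, without compactness of an
embedding. Part (i) holds because two distinct points of the manifold never lie on one ray
(`secant_ne_zero`). -/

theorem enorm_gradient (φ : Rn d → ℝ) (x : Rn d) : ‖gradient φ x‖ₑ = ‖fderiv ℝ φ x‖ₑ := by
  simp only [gradient, enorm_eq_nnnorm, LinearIsometryEquiv.nnnorm_map]

theorem IsTestFunction.support_subset {φ : Rn d → ℝ} (hφ : IsTestFunction Ω φ) :
    Function.support φ ⊆ Ω :=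
  (subset_tsupport φ).trans hφ.2.2

theorem IsTestFunction.support_fderiv_subset {φ : Rn d → ℝ} (hφ : IsTestFunction Ω φ) :
    Function.support (fderiv ℝ φ) ⊆ Ω :=
  (_root_.support_fderiv_subset ℝ).trans hφ.2.2

theorem IsTestFunction.eLpNorm_fderiv_restrict {φ : Rn d → ℝ} (hφ : IsTestFunction Ω φ)
    (p : ℝ≥0∞) :
    eLpNorm (fderiv ℝ φ) p (volume.restrict Ω) = eLpNorm (fderiv ℝ φ) p volume := by
  rw [← eLpNorm_norm, ← eLpNorm_norm (fderiv ℝ φ)]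
  refine eLpNorm_restrict_eq_of_support_subset (fun x hx => hφ.support_fderiv_subset ?_)
  rw [Function.mem_support] at hx ⊢
  exact norm_ne_zero_iff.1 hx

theorem eLpNorm_gradient_eq {φ : Rn d → ℝ} (p : ℝ≥0∞) :
    eLpNorm (gradient φ) p (volume.restrict Ω) = eLpNorm (fderiv ℝ φ) p (volume.restrict Ω) :=
  eLpNorm_congr_enorm_ae (Eventually.of_forall (enorm_gradient φ))

theorem IsTestFunction.contDiff_one {φ : Rn d → ℝ} (hφ : IsTestFunction Ω φ) :
    ContDiff ℝ 1 φ := hφ.1.of_le (by simp)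

theorem IsTestFunction.continuous_fderiv {φ : Rn d → ℝ} (hφ : IsTestFunction Ω φ) :
    Continuous (fderiv ℝ φ) := hφ.contDiff_one.continuous_fderiv one_ne_zero

/-- Lower exponents are controlled by higher ones on a bounded set. -/
theorem exists_eLpNorm_fderiv_le (hΩb : Bornology.IsBounded Ω) {p q : ℝ≥0∞} (hp : 0 < p)
    (hpq : p ≤ q) :
    ∃ C : ℝ≥0, ∀ φ : Rn d → ℝ, IsTestFunction Ω φ →
      eLpNorm (fderiv ℝ φ) p (volume.restrict Ω) ≤
        C * eLpNorm (fderiv ℝ φ) q (volume.restrict Ω) := by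
  have hμ : (volume.restrict Ω) univ ≠ ⊤ := by
    rw [Measure.restrict_apply_univ]; exact hΩb.measure_lt_top.ne
  have hne : (volume.restrict Ω) univ ^ (1 / p.toReal - 1 / q.toReal) ≠ ⊤ := by
    apply ENNReal.rpow_ne_top_of_nonneg _ hμ
    rcases eq_or_ne q ⊤ with rfl | hq
    · simp
    · have h0 : 0 < p.toReal := ENNReal.toReal_pos hp.ne' (ne_top_of_le_ne_top hq hpq)
      have := one_div_le_one_div_of_le h0 (ENNReal.toReal_mono hq hpq)
      linarith
  refine ⟨((volume.restrict Ω) univ ^ (1 / p.toReal - 1 / q.toReal)).toNNReal, fun φ hφ => ?_⟩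
  rw [ENNReal.coe_toNNReal hne, mul_comm]
  exact eLpNorm_le_eLpNorm_mul_rpow_measure_univ hpq hφ.continuous_fderiv.aestronglyMeasurable

/-- Gagliardo–Nirenberg–Sobolev bounds `‖φ‖₄` by `‖∇φ‖_p`; Hölder on the bounded set then raises `p`
to `2`. The free `p` is needed because the Sobolev step requires `p < d`. -/
theorem exists_eLpNorm_four_le_of_lt (hΩb : Bornology.IsBounded Ω) {p : ℝ≥0} (hp1 : 1 ≤ p)
    (hp2 : p ≤ 2) (hpd : p < d) (hp4 : (p : ℝ)⁻¹ - (d : ℝ)⁻¹ ≤ 4⁻¹) :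
    ∃ C : ℝ≥0, ∀ φ : Rn d → ℝ, IsTestFunction Ω φ →
      eLpNorm φ 4 (volume.restrict Ω) ≤ C * eLpNorm (gradient φ) 2 (volume.restrict Ω) := by
  obtain ⟨C, hC⟩ := exists_eLpNorm_fderiv_le (Ω := Ω) hΩb (p := p) (q := 2)
    (by exact_mod_cast zero_lt_one.trans_le hp1) (by exact_mod_cast hp2)
  refine ⟨eLpNormLESNormFDerivOfLeConst ℝ (volume : Measure (Rn d)) Ω p 4 * C, fun φ hφ => ?_⟩
  have h := eLpNorm_le_eLpNorm_fderiv_of_le (F := ℝ) (volume : Measure (Rn d)) (u := φ) (s := Ω)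
    (p := p) (q := 4) hφ.contDiff_one hφ.support_subset hp1 (by simpa using hpd)
    (by simpa using hp4) hΩb
  rw [← eLpNorm_restrict_eq_of_support_subset hφ.support_subset,
    ← hφ.eLpNorm_fderiv_restrict] at h
  rw [eLpNorm_gradient_eq]
  calc _ ≤ _ := h
    _ ≤ _ := mul_le_mul_right (hC φ hφ) _
    _ = _ := by rw [ENNReal.coe_mul, mul_assoc]

/-- No `p ≥ 1` satisfies `p < 1`, so dimension one is treated by the fundamental theorem of
calculus: `|φ|` is pointwise at most `∫ |φ'|`. The isometry `e` transports the integral on the line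
to `Rn 1`. -/
theorem exists_eLpNorm_four_le_of_one {Ω : Set (Rn 1)} (hΩb : Bornology.IsBounded Ω) :
    ∃ C : ℝ≥0, ∀ φ : Rn 1 → ℝ, IsTestFunction Ω φ →
      eLpNorm φ 4 (volume.restrict Ω) ≤ C * eLpNorm (gradient φ) 2 (volume.restrict Ω) := by
  obtain ⟨C, hC⟩ := exists_eLpNorm_fderiv_le (Ω := Ω) hΩb (p := 1) (q := 2) (by simp) (by simp)
  have hμ : (volume.restrict Ω) univ ^ ((4 : ℝ≥0∞).toReal⁻¹) ≠ ⊤ := by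
    rw [Measure.restrict_apply_univ]
    exact ENNReal.rpow_ne_top_of_nonneg (inv_nonneg.2 ENNReal.toReal_nonneg) hΩb.measure_lt_top.ne
  refine ⟨C * ((volume.restrict Ω) univ ^ ((4 : ℝ≥0∞).toReal⁻¹)).toNNReal, fun φ hφ => ?_⟩
  let e : ℝ → Rn 1 := fun s => WithLp.toLp 2 (fun _ => s)
  have he : MeasurePreserving e volume volume :=
    (PiLp.volume_preserving_toLp (Fin 1)).comp (volume_preserving_funUnique (Fin 1) ℝ).symm
  have hiso : Isometry e := by
    refine Isometry.of_dist_eq fun x y => ?_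
    simp [e, EuclideanSpace.dist_eq, Real.dist_eq, Real.sqrt_sq_eq_abs]
  have hd (y : ℝ) : HasDerivAt e (e 1) y := by
    have : e = fun s : ℝ => s • e 1 := by
      funext s; ext i; simp [e]
    rw [this]
    simpa using (hasDerivAt_id y).smul_const (e 1)
  have hcd : ContDiff ℝ 1 e := by
    have : e = fun s : ℝ => s • e 1 := by
      funext s; ext i; simp [e]
    rw [this]; exact contDiff_id.smul contDiff_const
  have hpt (x : Rn 1) : ‖φ x‖ₑ ≤ eLpNorm (fderiv ℝ φ) 1 (volume.restrict Ω) := by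
    have hx : x = e (x 0) := by ext i; fin_cases i; simp [e]
    rw [hφ.eLpNorm_fderiv_restrict,
      eLpNorm_one_eq_lintegral_enorm, ← he.lintegral_comp_emb
        (hiso.isClosedEmbedding.measurableEmbedding)]
    have h := HasCompactSupport.enorm_le_lintegral_Ici_deriv (f := φ ∘ e)
      (hφ.contDiff_one.comp hcd) (hφ.2.1.comp_isClosedEmbedding hiso.isClosedEmbedding) (x 0)
    rw [Function.comp_apply, ← hx] at h
    refine h.trans ((lintegral_mono' Measure.restrict_le_self le_rfl).trans
      (lintegral_mono fun y => ?_))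
    have : deriv (φ ∘ e) y = fderiv ℝ φ (e y) (e 1) := by
      rw [← (hd y).deriv]
      exact fderiv_comp_deriv y (hφ.contDiff_one.differentiable one_ne_zero _)
        (hd y).differentiableAt
    rw [this]
    refine (ContinuousLinearMap.le_opENorm _ _).trans ?_
    have h1 : ‖e 1‖ₑ = 1 := by
      rw [enorm_eq_nnnorm]
      have : ‖e 1‖ = 1 := by simp [e, EuclideanSpace.norm_eq]
      have h2 : ‖e 1‖₊ = 1 := NNReal.eq this
      simp [h2]
    rw [h1, mul_one]
  have h := eLpNorm_le_of_ae_enorm_bound (p := 4) (μ := volume.restrict Ω)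
    (Eventually.of_forall hpt)
  rw [eLpNorm_gradient_eq]
  refine h.trans ?_
  rw [ENNReal.coe_mul, ENNReal.coe_toNNReal hμ, smul_eq_mul, mul_right_comm]
  exact mul_le_mul_left (hC φ hφ) _

/-- The Sobolev inequality `‖φ‖₄ ≤ C ‖∇φ‖₂` for test functions in dimension at most four. -/
theorem exists_eLpNorm_four_le (hd1 : 1 ≤ d) (hd4 : d ≤ 4) (hΩb : Bornology.IsBounded Ω) :
    ∃ C : ℝ≥0, ∀ φ : Rn d → ℝ, IsTestFunction Ω φ →
      eLpNorm φ 4 (volume.restrict Ω) ≤ C * eLpNorm (gradient φ) 2 (volume.restrict Ω) := by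
  interval_cases d
  · exact exists_eLpNorm_four_le_of_one hΩb
  -- For `d = 2` the conditions `p < 2` and `1/p - 1/2 ≤ 1/4` leave `4/3 ≤ p < 2`. For `d = 3, 4`
  -- the choice `p = 2` works, with equality in the exponent condition at `d = 4`.
  · refine exists_eLpNorm_four_le_of_lt hΩb (p := 4 / 3) ?_ ?_ ?_ ?_
    · rw [one_le_div (by norm_num)]; norm_num
    · rw [div_le_iff₀ (by norm_num)]; norm_num
    · push_cast; rw [div_lt_iff₀ (by norm_num)]; norm_num
    · push_cast; norm_num
  · exact exists_eLpNorm_four_le_of_lt hΩb (p := 2) (by norm_num) le_rfl (by norm_num)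
      (by norm_num)
  · exact exists_eLpNorm_four_le_of_lt hΩb (p := 2) (by norm_num) le_rfl (by norm_num)
      (by norm_num)

end Nehari

end

/-! ### From test functions to `H_0^1(Ω)`: the `L⁴` embedding and uniqueness of the weak gradient.
-/

noncomputable section

namespace Nehari

open scoped NNReal

variable {d : ℕ} {Ω : Set (Rn d)}

theorem exists_seq (u : H01 Ω) :
    ∃ p : ℕ → GraphSpace Ω, (∀ n, p n ∈ testGraphs Ω) ∧ Tendsto p atTop (𝓝 u.1) := by
  have h : u.1 ∈ closure (testGraphs Ω : Set (GraphSpace Ω)) := u.2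
  exact mem_closure_iff_seq_limit.1 h

instance fact_one_le_four : Fact ((1 : ℝ≥0∞) ≤ 4) := ⟨by norm_num⟩

/-- An inequality between `‖φ‖₄` and `‖∇φ‖₂` extends from test functions to `H_0^1(Ω)`. -/
theorem eLpNorm_four_val_le {C : ℝ≥0} (hC : ∀ φ : Rn d → ℝ, IsTestFunction Ω φ →
    eLpNorm φ 4 (volume.restrict Ω) ≤ C * eLpNorm (gradient φ) 2 (volume.restrict Ω))
    (u : H01 Ω) :
    eLpNorm (val u) 4 (volume.restrict Ω) ≤ C * eLpNorm (grad u) 2 (volume.restrict Ω) := by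
  obtain ⟨p, hp, hlim⟩ := exists_seq u
  have h1 : Tendsto (fun n => (p n).1) atTop (𝓝 u.1.1) := (continuous_fst.tendsto _).comp hlim
  have h2 : Tendsto (fun n => (p n).2) atTop (𝓝 u.1.2) := (continuous_snd.tendsto _).comp hlim
  -- Along an a.e. convergent subsequence, Fatou makes the `L⁴` norm lower semicontinuous, while the
  -- right-hand side converges.
  obtain ⟨ns, hns, hae⟩ := (tendstoInMeasure_of_tendsto_Lp h1).exists_seq_tendsto_ae
  have h3 : Tendsto (fun n => (C : ℝ≥0∞) * ‖(p (ns n)).2‖ₑ) atTop (𝓝 (C * ‖u.1.2‖ₑ)) :=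
    ENNReal.Tendsto.const_mul ((continuous_enorm.tendsto _).comp (h2.comp hns.tendsto_atTop))
      (Or.inr ENNReal.coe_ne_top)
  have hg : C * eLpNorm (grad u) 2 (volume.restrict Ω) = C * ‖u.1.2‖ₑ := by
    rw [Lp.enorm_def]; rfl
  rw [hg, ← h3.liminf_eq]
  refine (Lp.eLpNorm_lim_le_liminf_eLpNorm
    (fun n => (Lp.aestronglyMeasurable (p (ns n)).1)) (val u) hae).trans ?_
  refine liminf_le_liminf (Eventually.of_forall fun n => ?_)
  obtain ⟨φ, hφ, e1, e2⟩ := hp (ns n)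
  rw [eLpNorm_congr_ae e1, Lp.enorm_def, eLpNorm_congr_ae e2]
  exact hC φ hφ

theorem memLp_val (u : H01 Ω) : MemLp (val u) 2 (volume.restrict Ω) := Lp.memLp _

theorem memLp_grad (u : H01 Ω) : MemLp (grad u) 2 (volume.restrict Ω) := Lp.memLp _

theorem val_add (u v : H01 Ω) : val (u + v) =ᵐ[volume.restrict Ω] val u + val v :=
  Lp.coeFn_add u.1.1 v.1.1

theorem val_smul (c : ℝ) (u : H01 Ω) : val (c • u) =ᵐ[volume.restrict Ω] c • val u :=
  Lp.coeFn_smul c u.1.1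

theorem norm_snd_le (u : H01 Ω) : ‖u.1.2‖ ≤ ‖u‖ := _root_.norm_snd_le u.1

/-- The Sobolev embedding of `H_0^1(Ω)` into `L⁴(Ω)`. -/
theorem exists_toL4 (hd1 : 1 ≤ d) (hd4 : d ≤ 4) (hΩb : Bornology.IsBounded Ω) :
    ∃ (J : H01 Ω →L[ℝ] Lp ℝ 4 (volume.restrict Ω)) (C : ℝ), 0 < C ∧
      (∀ u, J u =ᵐ[volume.restrict Ω] val u) ∧ ∀ u, ‖J u‖ ≤ C * ‖u.1.2‖ := by
  obtain ⟨C, hC⟩ := exists_eLpNorm_four_le (Ω := Ω) hd1 hd4 hΩb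
  have hle := eLpNorm_four_val_le hC
  have hmem (u : H01 Ω) : MemLp (val u) 4 (volume.restrict Ω) :=
    ⟨(memLp_val u).1, (hle u).trans_lt
      (ENNReal.mul_lt_top ENNReal.coe_lt_top (memLp_grad u).2)⟩
  let J₀ : H01 Ω →ₗ[ℝ] Lp ℝ 4 (volume.restrict Ω) :=
    { toFun := fun u => (hmem u).toLp
      map_add' := fun u v => by
        rw [← MemLp.toLp_add]
        exact MemLp.toLp_congr _ _ (val_add u v)
      map_smul' := fun c u => by
        rw [RingHom.id_apply, ← MemLp.toLp_const_smul]
        exact MemLp.toLp_congr _ _ (val_smul c u) }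
  have hJ (u : H01 Ω) : ‖J₀ u‖ ≤ (C + 1) * ‖u.1.2‖ := by
    have h : ‖J₀ u‖ ≤ C * ‖u.1.2‖ := by
      change ‖(hmem u).toLp‖ ≤ _
      rw [Lp.norm_toLp, Lp.norm_def, ← ENNReal.coe_toReal, ← ENNReal.toReal_mul]
      exact ENNReal.toReal_mono (ENNReal.mul_ne_top ENNReal.coe_ne_top (memLp_grad u).2.ne)
        (hle u)
    nlinarith [norm_nonneg u.1.2]
  refine ⟨J₀.mkContinuous (C + 1) fun u => (hJ u).trans
    (mul_le_mul_of_nonneg_left (norm_snd_le u) (by positivity)), C + 1, by positivity,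
    fun u => MemLp.coeFn_toLp (hmem u), hJ⟩

/-- For fixed `ψ` both terms are continuous in the pair `(u, ∇u)`, so integration by parts for test
functions passes to the closure. -/
theorem integral_val_mul_fderiv (u : H01 Ω) {ψ : Rn d → ℝ}
    (hψ : IsTestFunction Ω ψ) (v : Rn d) :
    (∫ x in Ω, fderiv ℝ ψ x v * val u x) + ∫ x in Ω, ψ x * inner ℝ v (grad u x) = 0 := by
  have hc1 : Continuous fun x => fderiv ℝ ψ x v := hψ.continuous_fderiv.clm_apply continuous_const
  have hs1 : HasCompactSupport fun x => fderiv ℝ ψ x v := hψ.2.1.fderiv_apply (𝕜 := ℝ) v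
  have hc2 : Continuous fun x => ψ x • v := hψ.1.continuous.smul continuous_const
  have hs2 : HasCompactSupport fun x => ψ x • v := hψ.2.1.smul_right
  have m1 : MemLp (fun x => fderiv ℝ ψ x v) 2 (volume.restrict Ω) :=
    hc1.memLp_of_hasCompactSupport hs1
  have m2 : MemLp (fun x => ψ x • v) 2 (volume.restrict Ω) :=
    hc2.memLp_of_hasCompactSupport hs2
  have key (p : GraphSpace Ω) : inner ℝ m1.toLp p.1 + inner ℝ m2.toLp p.2 =
      (∫ x in Ω, fderiv ℝ ψ x v * p.1 x) + ∫ x in Ω, ψ x * inner ℝ v (p.2 x) := by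
    rw [L2.inner_def, L2.inner_def]
    congr 1
    · refine integral_congr_ae ?_
      filter_upwards [m1.coeFn_toLp] with x hx
      rw [hx]; simp [mul_comm]
    · refine integral_congr_ae ?_
      filter_upwards [m2.coeFn_toLp] with x hx
      rw [hx, real_inner_smul_left]
  obtain ⟨p, hp, hlim⟩ := exists_seq u
  have hcont : Continuous fun p : GraphSpace Ω => inner ℝ m1.toLp p.1 + inner ℝ m2.toLp p.2 := by
    fun_prop
  have hl := (hcont.tendsto u.1).comp hlim
  have hz : ∀ n, inner ℝ m1.toLp (p n).1 + inner ℝ m2.toLp (p n).2 = 0 := by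
    intro n
    rw [key]
    obtain ⟨φ, hφ, e1, e2⟩ := hp n
    have i1 : ∫ x in Ω, fderiv ℝ ψ x v * (p n).1 x = ∫ x, fderiv ℝ ψ x v * φ x := by
      refine Eq.trans ?_ (setIntegral_eq_integral_of_forall_compl_eq_zero (s := Ω) ?_)
      · refine integral_congr_ae ?_
        filter_upwards [e1] with x hx
        rw [hx]
      · intro x hx
        rw [Function.notMem_support.1 fun h => hx (hφ.support_subset h), mul_zero]
    have i2 : ∫ x in Ω, ψ x * inner ℝ v ((p n).2 x) = ∫ x, ψ x * fderiv ℝ φ x v := by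
      refine Eq.trans ?_ (setIntegral_eq_integral_of_forall_compl_eq_zero (s := Ω) ?_)
      · refine integral_congr_ae ?_
        filter_upwards [e2] with x hx
        rw [hx, real_inner_comm, gradient, InnerProductSpace.toDual_symm_apply]
      · intro x hx
        rw [Function.notMem_support.1 fun h => hx (hψ.support_subset h), zero_mul]
    rw [i1, i2, integral_mul_fderiv_eq_neg_fderiv_mul_of_integrable, add_neg_cancel]
    · exact (hc1.mul hφ.1.continuous).integrable_of_hasCompactSupport hs1.mul_right
    · exact (hψ.1.continuous.mul (hφ.continuous_fderiv.clm_apply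
        continuous_const)).integrable_of_hasCompactSupport hψ.2.1.mul_right
    · exact (hψ.1.continuous.mul hφ.1.continuous).integrable_of_hasCompactSupport
        hψ.2.1.mul_right
    · exact fun x _ => hψ.contDiff_one.differentiable one_ne_zero x
    · exact fun x _ => hφ.contDiff_one.differentiable one_ne_zero x
  have : inner ℝ m1.toLp u.1.1 + inner ℝ m2.toLp u.1.2 = 0 :=
    tendsto_nhds_unique hl (by simp only [Function.comp_def, hz]; exact tendsto_const_nhds)
  rw [key] at this
  exact this

/-- An element of `H_0^1(Ω)` is determined by its underlying function. -/
theorem eq_zero_of_val (hΩo : IsOpen Ω) (hΩb : Bornology.IsBounded Ω) {u : H01 Ω}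
    (hu : val u =ᵐ[volume.restrict Ω] 0) : u = 0 := by
  have : IsFiniteMeasure (volume.restrict Ω) := ⟨by
    rw [Measure.restrict_apply_univ]; exact hΩb.measure_lt_top⟩
  -- When `u = 0`, integration by parts leaves each directional weak derivative orthogonal to all
  -- test functions.
  have hg (v : Rn d) : ∀ᵐ x ∂(volume.restrict Ω), inner ℝ v (grad u x) = 0 := by
    have hint : IntegrableOn (fun x => inner ℝ v (grad u x)) Ω :=
      ((memLp_grad u).integrable one_le_two).const_inner v
    rw [ae_restrict_iff' hΩo.measurableSet]
    refine hΩo.ae_eq_zero_of_integral_contDiff_smul_eq_zero hint.locallyIntegrableOn ?_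
    intro ψ h1 h2 h3
    have h := integral_val_mul_fderiv u ⟨h1, h2, h3⟩ v
    have h0 : ∫ x in Ω, fderiv ℝ ψ x v * val u x = 0 := by
      rw [integral_congr_ae (g := fun _ => (0 : ℝ))]
      · simp
      · filter_upwards [hu] with x hx
        rw [hx]; simp
    rw [h0, zero_add] at h
    rw [← setIntegral_eq_integral_of_forall_compl_eq_zero (s := Ω)]
    · exact h
    · intro x hx
      rw [Function.notMem_support.1 fun h => hx (h3 (subset_tsupport _ h)), zero_smul]
  have hgr : grad u =ᵐ[volume.restrict Ω] 0 := by
    have := ae_all_iff.2 fun i : Fin d => hg (EuclideanSpace.single i 1)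
    filter_upwards [this] with x hx
    ext i
    simpa [EuclideanSpace.inner_single_left] using hx i
  apply Subtype.ext
  refine Prod.ext ?_ ?_
  · exact (Lp.eq_zero_iff_ae_eq_zero).2 hu
  · exact (Lp.eq_zero_iff_ae_eq_zero).2 hgr

end Nehari

end

/-! ### Products of `L⁴` functions and coercivity of `ε |∇u|² + a u²`. -/

noncomputable section

namespace Nehari

open scoped NNReal

variable {d m : ℕ} {Ω : Set (Rn d)}

theorem lambda1_nonneg : 0 ≤ lambda1 Ω := by
  refine Real.sInf_nonneg ?_
  rintro r ⟨u, -, rfl⟩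
  exact integral_nonneg fun x => by positivity

theorem integral_grad_sq (u : H01 Ω) : ∫ x in Ω, ‖grad u x‖ ^ 2 = ‖u.1.2‖ ^ 2 := by
  rw [← real_inner_self_eq_norm_sq, L2.inner_def]
  simp only [real_inner_self_eq_norm_sq]
  rfl

theorem integral_val_sq (u : H01 Ω) : ∫ x in Ω, val u x ^ 2 = ‖u.1.1‖ ^ 2 := by
  rw [← real_inner_self_eq_norm_sq, L2.inner_def]
  simp only [real_inner_self_eq_norm_sq, Real.norm_eq_abs, sq_abs]
  rfl

/-- The Poincaré inequality with the first Dirichlet eigenvalue. -/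
theorem lambda1_mul_le (u : H01 Ω) : lambda1 Ω * ‖u.1.1‖ ^ 2 ≤ ‖u.1.2‖ ^ 2 := by
  rcases eq_or_ne ‖u.1.1‖ 0 with h | h
  · rw [h]; nlinarith [sq_nonneg ‖u.1.2‖]
  have h' : 0 < ‖u.1.1‖ := lt_of_le_of_ne (norm_nonneg _) h.symm
  have hle : lambda1 Ω ≤ ‖((‖u.1.1‖⁻¹ • u : H01 Ω)).1.2‖ ^ 2 := by
    refine csInf_le ⟨0, ?_⟩ ⟨‖u.1.1‖⁻¹ • u, ?_, (integral_grad_sq _).symm⟩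
    · rintro r ⟨v, -, rfl⟩
      exact integral_nonneg fun x => by positivity
    · rw [integral_val_sq]
      change ‖‖u.1.1‖⁻¹ • u.1.1‖ ^ 2 = 1
      rw [norm_smul, norm_inv, norm_norm, inv_mul_cancel₀ h, one_pow]
  have h2 : ‖((‖u.1.1‖⁻¹ • u : H01 Ω)).1.2‖ = ‖u.1.1‖⁻¹ * ‖u.1.2‖ := by
    change ‖‖u.1.1‖⁻¹ • u.1.2‖ = _
    rw [norm_smul, norm_inv, norm_norm]
  rw [h2, mul_pow, inv_pow, ← div_eq_inv_mul, le_div_iff₀ (by positivity)] at hle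
  exact hle

instance holderTriple_four : ENNReal.HolderTriple 4 4 2 := ⟨by
  rw [← two_mul, show (4 : ℝ≥0∞) = 2 * 2 by norm_num,
    ENNReal.mul_inv (by simp) (by simp), ← mul_assoc,
    ENNReal.mul_inv_cancel (by simp) (by simp), one_mul]⟩

/-- The product of two functions in `L⁴(Ω)`, as an element of `L²(Ω)`. -/
abbrev mulL4 (Ω : Set (Rn d)) : Lp ℝ 4 (volume.restrict Ω) →L[ℝ] Lp ℝ 4 (volume.restrict Ω) →L[ℝ]
    Lp ℝ 2 (volume.restrict Ω) :=
  (ContinuousLinearMap.mul ℝ ℝ).holderL (volume.restrict Ω) 4 4 2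

theorem coeFn_mulL4 (x y : Lp ℝ 4 (volume.restrict Ω)) :
    mulL4 Ω x y =ᵐ[volume.restrict Ω] fun t => x t * y t :=
  ContinuousLinearMap.coeFn_holder _ x y

theorem norm_mulL4_le (x y : Lp ℝ 4 (volume.restrict Ω)) : ‖mulL4 Ω x y‖ ≤ ‖x‖ * ‖y‖ := by
  have h := ContinuousLinearMap.norm_holder_apply_apply_le (r := 2)
    (ContinuousLinearMap.mul ℝ ℝ) x y
  rw [ContinuousLinearMap.opNorm_mul, one_mul] at h
  exact h

theorem norm_mulL4_self (x : Lp ℝ 4 (volume.restrict Ω)) : ‖mulL4 Ω x x‖ = ‖x‖ ^ 2 := by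
  rw [Lp.norm_def, eLpNorm_congr_ae (coeFn_mulL4 x x), Lp.norm_def, ← ENNReal.toReal_pow]
  congr 1
  have h := eLpNorm_norm_rpow (p := 2) (μ := volume.restrict Ω) (x : Rn d → ℝ) (q := 2)
    (by norm_num)
  have h4 : (2 : ℝ≥0∞) * ENNReal.ofReal 2 = 4 := by
    rw [ENNReal.ofReal_ofNat]; norm_num
  rw [h4, ENNReal.rpow_ofNat] at h
  rw [← h]
  refine eLpNorm_congr_ae (Eventually.of_forall fun t => ?_)
  simp [← pow_two]

/-- A positive weight controls the `L²`-norm up to a small multiple of the square of the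
`L⁴`-norm. -/
theorem exists_norm_sq_le_of_pos (hΩb : Bornology.IsBounded Ω)
    {J : H01 Ω →L[ℝ] Lp ℝ 4 (volume.restrict Ω)} (hJ : ∀ u, J u =ᵐ[volume.restrict Ω] val u)
    {b : Rn d → ℝ} (hb : MemLp b ∞ (volume.restrict Ω))
    (hb0 : ∀ᵐ x ∂(volume.restrict Ω), 0 < b x) {δ : ℝ} (hδ : 0 < δ) :
    ∃ n : ℝ, 0 < n ∧ ∀ u : H01 Ω,
      ‖u.1.1‖ ^ 2 ≤ n * (∫ x in Ω, b x * val u x ^ 2) + δ * ‖J u‖ ^ 2 := by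
  have hfin : IsFiniteMeasure (volume.restrict Ω) := ⟨by
    rw [Measure.restrict_apply_univ]; exact hΩb.measure_lt_top⟩
  -- Since `1 ≤ n b + h n`, one has `∫ u² ≤ n ∫ b u² + ∫ u² h n`. As `b > 0` a.e., `h n → 0` in `L²`
  -- by dominated convergence, and Cauchy–Schwarz bounds the last integral by `‖h n‖₂ ‖u‖₄²`.
  let h : ℕ → Rn d → ℝ := fun n x => max 0 (1 - n * b x)
  have hmeas (n : ℕ) : AEStronglyMeasurable (h n) (volume.restrict Ω) :=
    aestronglyMeasurable_const.sup (aestronglyMeasurable_const.sub (hb.1.const_mul _))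
  have h01 (n : ℕ) : ∀ᵐ x ∂(volume.restrict Ω), 0 ≤ h n x ∧ h n x ≤ 1 := by
    filter_upwards [hb0] with x hx
    exact ⟨le_max_left _ _, max_le zero_le_one (by nlinarith [mul_nonneg n.cast_nonneg hx.le])⟩
  have hmem (n : ℕ) : MemLp (h n) 2 (volume.restrict Ω) := by
    refine MemLp.of_bound (hmeas n) 1 ?_
    filter_upwards [h01 n] with x hx
    rw [Real.norm_eq_abs, abs_of_nonneg hx.1]; exact hx.2
  have hlim : Tendsto (fun n => ∫ x in Ω, h n x ^ 2) atTop (𝓝 (∫ x in Ω, (0 : ℝ))) := by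
    refine tendsto_integral_of_dominated_convergence (fun _ => 1) (fun n => (hmeas n).pow 2)
      (integrable_const 1) (fun n => ?_) ?_
    · filter_upwards [h01 n] with x hx
      rw [Real.norm_eq_abs, abs_of_nonneg (sq_nonneg _)]
      exact pow_le_one₀ hx.1 hx.2
    · filter_upwards [hb0] with x hx
      obtain ⟨N, hN⟩ := exists_nat_gt (1 / b x)
      refine tendsto_const_nhds.congr' ?_
      filter_upwards [eventually_ge_atTop N] with n hn
      have : 1 ≤ n * b x := by
        rw [← div_le_iff₀ hx]
        exact hN.le.trans (by exact_mod_cast hn)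
      simp only [h]
      rw [max_eq_left (by linarith)]; norm_num
  rw [integral_zero] at hlim
  obtain ⟨n, hn, hn1⟩ := ((hlim.eventually_lt_const (show (0 : ℝ) < δ ^ 2 by positivity)).and
    (eventually_ge_atTop 1)).exists
  have hnorm : ‖(hmem n).toLp‖ ≤ δ := by
    have : ‖(hmem n).toLp‖ ^ 2 = ∫ x in Ω, h n x ^ 2 := by
      rw [← real_inner_self_eq_norm_sq, L2.inner_def]
      refine integral_congr_ae ?_
      filter_upwards [(hmem n).coeFn_toLp] with x hx
      rw [hx, real_inner_self_eq_norm_sq, Real.norm_eq_abs, sq_abs]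
    rw [← this] at hn
    exact (abs_le_of_sq_le_sq' hn.le hδ.le).2
  refine ⟨n, by exact_mod_cast hn1, fun u => ?_⟩
  have hu2 : Integrable (fun x => val u x ^ 2) (volume.restrict Ω) := (memLp_val u).integrable_sq
  have hbu : Integrable (fun x => b x * val u x ^ 2) (volume.restrict Ω) :=
    hu2.essSup_smul hb.1 hb.2.ne
  have hhu : Integrable (fun x => val u x ^ 2 * h n x) (volume.restrict Ω) :=
    hu2.mul_bdd (c := 1) (hmeas n) (by
      filter_upwards [h01 n] with x hx
      rw [Real.norm_eq_abs, abs_of_nonneg hx.1]; exact hx.2)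
  have hin : ∫ x in Ω, val u x ^ 2 * h n x = inner ℝ (mulL4 Ω (J u) (J u)) (hmem n).toLp := by
    rw [L2.inner_def]
    refine integral_congr_ae ?_
    filter_upwards [(hmem n).coeFn_toLp, coeFn_mulL4 (J u) (J u), hJ u] with x h1 h2 h3
    rw [h1, h2, h3]
    simp [pow_two, mul_comm]
  have hb2 : ∫ x in Ω, val u x ^ 2 * h n x ≤ δ * ‖J u‖ ^ 2 := by
    rw [hin]
    refine (real_inner_le_norm _ _).trans ?_
    rw [norm_mulL4_self, mul_comm]
    exact mul_le_mul_of_nonneg_right hnorm (sq_nonneg _)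
  rw [← integral_val_sq]
  calc ∫ x in Ω, val u x ^ 2 ≤ ∫ x in Ω, (n * (b x * val u x ^ 2) + val u x ^ 2 * h n x) := by
        refine integral_mono hu2 ((hbu.const_mul _).add hhu) fun x => ?_
        have : 1 - n * b x ≤ h n x := le_max_right _ _
        nlinarith [sq_nonneg (val u x)]
    _ = n * (∫ x in Ω, b x * val u x ^ 2) + ∫ x in Ω, val u x ^ 2 * h n x := by
        rw [integral_add (hbu.const_mul _) hhu, integral_const_mul]
    _ ≤ _ := by linarith

theorem integrable_mul_val_sq {b : Rn d → ℝ} (hb : MemLp b ∞ (volume.restrict Ω)) (u : H01 Ω) :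
    Integrable (fun x => b x * val u x ^ 2) (volume.restrict Ω) :=
  (memLp_val u).integrable_sq.essSup_smul hb.1 hb.2.ne

/-- The quadratic form `ε |∇u|² + a u²` is coercive as soon as `a > -ε λ₁` almost everywhere. -/
theorem exists_coercive (hΩb : Bornology.IsBounded Ω)
    {J : H01 Ω →L[ℝ] Lp ℝ 4 (volume.restrict Ω)} (hJ : ∀ u, J u =ᵐ[volume.restrict Ω] val u)
    {C : ℝ} (hC : 0 < C) (hJC : ∀ u, ‖J u‖ ≤ C * ‖u.1.2‖) {ε : ℝ} (hε : 0 < ε)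
    {a : Rn d → ℝ} (ha : MemLp a ∞ (volume.restrict Ω))
    (hal : ∀ᵐ x ∂(volume.restrict Ω), -(ε * lambda1 Ω) < a x) :
    ∃ κ : ℝ, 0 < κ ∧ ∀ u : H01 Ω,
      κ * ‖u.1.2‖ ^ 2 ≤ ε * ‖u.1.2‖ ^ 2 + ∫ x in Ω, a x * val u x ^ 2 := by
  have hfin : IsFiniteMeasure (volume.restrict Ω) := ⟨by
    rw [Measure.restrict_apply_univ]; exact hΩb.measure_lt_top⟩
  set l := lambda1 Ω with hl
  have hl0 : 0 ≤ l := lambda1_nonneg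
  have hb : MemLp (fun x => a x + ε * l) ∞ (volume.restrict Ω) := ha.add (memLp_const _)
  have hb0 : ∀ᵐ x ∂(volume.restrict Ω), 0 < a x + ε * l := by
    filter_upwards [hal] with x hx
    linarith
  -- With this `δ` the `L⁴` term costs at most `D / (4 (l + 1))`, half of the lower bound for `s` in
  -- the second case below. Using `l + 1` instead of `l` keeps denominators positive knowing only `l
  -- ≥ 0`.
  obtain ⟨n, hn, hnu⟩ := exists_norm_sq_le_of_pos hΩb hJ hb hb0
    (δ := 1 / (4 * (l + 1) * C ^ 2)) (by positivity)
  refine ⟨min (ε / 2) (1 / (4 * (l + 1) * n)), by positivity, fun u => ?_⟩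
  have hsplit : ∫ x in Ω, (a x + ε * l) * val u x ^ 2 =
      (∫ x in Ω, a x * val u x ^ 2) + ε * l * ‖u.1.1‖ ^ 2 := by
    simp only [add_mul]
    rw [integral_add (integrable_mul_val_sq ha u) ((memLp_val u).integrable_sq.const_mul _),
      integral_const_mul, integral_val_sq]
  have hpos : 0 ≤ ∫ x in Ω, (a x + ε * l) * val u x ^ 2 := by
    refine integral_nonneg_of_ae ?_
    filter_upwards [hb0] with x hx
    exact mul_nonneg hx.le (sq_nonneg _)
  have hle := hnu u
  have hp := lambda1_mul_le u
  rw [← hl] at hp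
  have hJ2 : ‖J u‖ ^ 2 ≤ C ^ 2 * ‖u.1.2‖ ^ 2 := by
    rw [← mul_pow]; exact pow_le_pow_left₀ (norm_nonneg _) (hJC u) 2
  have hδ : 1 / (4 * (l + 1) * C ^ 2) * ‖J u‖ ^ 2 ≤ 1 / (4 * (l + 1)) * ‖u.1.2‖ ^ 2 := by
    calc _ ≤ 1 / (4 * (l + 1) * C ^ 2) * (C ^ 2 * ‖u.1.2‖ ^ 2) := by gcongr
      _ = _ := by field_simp
  set D := ‖u.1.2‖ ^ 2 with hD
  set s := ‖u.1.1‖ ^ 2 with hs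
  have hD0 : 0 ≤ D := sq_nonneg _
  have hs0 : 0 ≤ s := sq_nonneg _
  set T := ∫ x in Ω, (a x + ε * l) * val u x ^ 2
  have hgoal : ε * D + ∫ x in Ω, a x * val u x ^ 2 = ε * (D - l * s) + T := by
    rw [hsplit]; ring
  rw [hgoal]
  -- The form equals `ε (D - l s) + T`, both terms nonnegative. Far from equality in the Poincaré
  -- inequality the first term controls `D`; otherwise `s` is comparable with `D` and `T` controls
  -- it.
  rcases le_or_gt (l * s) (D / 2) with hc | hc
  · have : min (ε / 2) (1 / (4 * (l + 1) * n)) * D ≤ ε / 2 * D :=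
      mul_le_mul_of_nonneg_right (min_le_left _ _) hD0
    nlinarith
  · have h1 : min (ε / 2) (1 / (4 * (l + 1) * n)) * D ≤ 1 / (4 * (l + 1) * n) * D :=
      mul_le_mul_of_nonneg_right (min_le_right _ _) hD0
    have h2 : 1 / (2 * (l + 1)) * D ≤ s := by
      rw [one_div_mul_eq_div, div_le_iff₀ (by positivity)]
      nlinarith
    have h3 : 1 / (4 * (l + 1)) * D ≤ n * T := by
      have : 1 / (2 * (l + 1)) * D = 2 * (1 / (4 * (l + 1)) * D) := by field_simp; ring
      linarith
    have h4 : 1 / (4 * (l + 1) * n) * D ≤ T := by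
      have : 1 / (4 * (l + 1) * n) * D = (1 / (4 * (l + 1)) * D) / n := by field_simp
      rw [this, div_le_iff₀ hn, mul_comm T]
      exact h3
    nlinarith

end Nehari

end

/-! ### The secant estimate for an abstract quadratic form and quartic form. -/

noncomputable section

namespace Nehari

theorem abs_sqrt_sub_one_le {r : ℝ} (hr : 0 ≤ r) : |√r - 1| ≤ |r - 1| := by
  have h : r - 1 = (√r - 1) * (√r + 1) := by
    have := Real.mul_self_sqrt hr
    linarith [show (√r - 1) * (√r + 1) = √r * √r - 1 by ring]
  have h1 : 1 ≤ |√r + 1| := by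
    rw [abs_of_nonneg (by positivity)]; linarith [Real.sqrt_nonneg r]
  rw [h, abs_mul]
  exact le_mul_of_one_le_right (abs_nonneg _) h1

/-- A quartic polynomial vanishing at `0` and `-1` is controlled on `[0, 1]` by its coefficients of
degree at least two. -/
theorem abs_quartic_le {f₁ f₂ f₃ f₄ t : ℝ} (h : -f₁ + f₂ - f₃ + f₄ = 0) (ht : t ∈ Icc (0 : ℝ) 1) :
    |t * f₁ + t ^ 2 * f₂ + t ^ 3 * f₃ + t ^ 4 * f₄| ≤ 2 * |f₂| + |f₃| + 2 * |f₄| := by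
  obtain ⟨h0, h1⟩ := ht
  have e : t * f₁ + t ^ 2 * f₂ + t ^ 3 * f₃ + t ^ 4 * f₄ =
      (t + t ^ 2) * f₂ + (t ^ 3 - t) * f₃ + (t + t ^ 4) * f₄ := by
    rw [show f₁ = f₂ - f₃ + f₄ by linarith]; ring
  have t2 : t ^ 2 ≤ 1 := pow_le_one₀ h0 h1
  have t3 : t ^ 3 ≤ 1 := pow_le_one₀ h0 h1
  have t4 : t ^ 4 ≤ 1 := pow_le_one₀ h0 h1
  have p3 : 0 ≤ t ^ 3 := by positivity
  rw [e]
  refine (abs_add_three _ _ _).trans ?_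
  rw [abs_mul, abs_mul, abs_mul]
  have a2 : |t + t ^ 2| ≤ 2 := by rw [abs_of_nonneg (by positivity)]; linarith
  have a3 : |t ^ 3 - t| ≤ 1 := by rw [abs_le]; constructor <;> linarith
  have a4 : |t + t ^ 4| ≤ 2 := by rw [abs_of_nonneg (by positivity)]; linarith
  have := mul_le_mul_of_nonneg_right a2 (abs_nonneg f₂)
  have := mul_le_mul_of_nonneg_right a3 (abs_nonneg f₃)
  have := mul_le_mul_of_nonneg_right a4 (abs_nonneg f₄)
  linarith

section Abstract

variable {V W : Type*} [AddCommGroup V] [Module ℝ V] [AddCommGroup W] [Module ℝ W]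
  (B : V →ₗ[ℝ] V →ₗ[ℝ] ℝ) (P : V →ₗ[ℝ] V →ₗ[ℝ] W) (G : W →ₗ[ℝ] W →ₗ[ℝ] ℝ)

theorem quartic_expansion (hP : ∀ x y, P x y = P y x) (u v : V) (s : ℝ) :
    G (P (u + s • v) (u + s • v)) (P (u + s • v) (u + s • v)) =
      G (P u u) (P u u) + s * (2 * (G (P u u) (P u v) + G (P u v) (P u u))) +
      s ^ 2 * (G (P u u) (P v v) + G (P v v) (P u u) + 4 * G (P u v) (P u v)) +
      s ^ 3 * (2 * (G (P u v) (P v v) + G (P v v) (P u v))) + s ^ 4 * G (P v v) (P v v) := by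
  have h : P (u + s • v) (u + s • v) = P u u + (2 * s) • P u v + s ^ 2 • P v v := by
    simp only [map_add, LinearMap.add_apply, map_smul, LinearMap.smul_apply, hP v u]
    module
  rw [h]
  simp only [map_add, LinearMap.add_apply, map_smul, LinearMap.smul_apply, smul_eq_mul]
  ring

theorem quadratic_expansion (u v : V) (s : ℝ) :
    B (u + s • v) (u + s • v) = B u u + s * (B u v + B v u) + s ^ 2 * B v v := by
  simp only [map_add, LinearMap.add_apply, map_smul, LinearMap.smul_apply, smul_eq_mul]
  ring

variable {B P G} {X N : Seminorm ℝ V} {S κ Λ M c : ℝ}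

/-- Bound for the defect of the Nehari identity along a secant. -/
theorem abs_defect_le (hP : ∀ x y, P x y = P y x) (hΛ : ∀ v, B v v ≤ Λ * X v ^ 2)
    (hB0 : ∀ v, 0 ≤ B v v)
    (hM : ∀ x y z w, |G (P x y) (P z w)| ≤ M * (N x * N y * (N z * N w)))
    {u v : V} (hu : B u u = G (P u u) (P u u))
    (hv : B (u - v) (u - v) = G (P (u - v) (u - v)) (P (u - v) (u - v)))
    {t : ℝ} (ht : t ∈ Icc (0 : ℝ) 1) :
    |B (u + t • v) (u + t • v) - G (P (u + t • v) (u + t • v)) (P (u + t • v) (u + t • v))| ≤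
      2 * Λ * X v ^ 2 + M * (12 * (N u ^ 2 * N v ^ 2) + 4 * (N u * N v ^ 3) + 2 * N v ^ 4) := by
  -- The second endpoint is the parameter `-1`, so `hv` becomes the relation `hrel` that eliminates
  -- `f₁`, the only coefficient linear in `v`.
  have hsub : u - v = u + (-1 : ℝ) • v := by module
  rw [hsub, quadratic_expansion, quartic_expansion P G hP] at hv
  rw [quadratic_expansion, quartic_expansion P G hP]
  set f₂ := B v v - (G (P u u) (P v v) + G (P v v) (P u u) + 4 * G (P u v) (P u v)) with h2
  set f₃ := -(2 * (G (P u v) (P v v) + G (P v v) (P u v))) with h3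
  set f₄ := -G (P v v) (P v v) with h4
  set f₁ := B u v + B v u - 2 * (G (P u u) (P u v) + G (P u v) (P u u)) with h1
  have hrel : -f₁ + f₂ - f₃ + f₄ = 0 := by rw [h1, h2, h3, h4]; linarith
  have hq := abs_quartic_le hrel ht
  have e : B u u + t * (B u v + B v u) + t ^ 2 * B v v -
      (G (P u u) (P u u) + t * (2 * (G (P u u) (P u v) + G (P u v) (P u u))) +
      t ^ 2 * (G (P u u) (P v v) + G (P v v) (P u u) + 4 * G (P u v) (P u v)) +
      t ^ 3 * (2 * (G (P u v) (P v v) + G (P v v) (P u v))) + t ^ 4 * G (P v v) (P v v)) =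
      t * f₁ + t ^ 2 * f₂ + t ^ 3 * f₃ + t ^ 4 * f₄ := by
    rw [h1, h2, h3, h4, hu]; ring
  rw [e]
  refine hq.trans ?_
  have b2 : |f₂| ≤ Λ * X v ^ 2 + 6 * (M * (N u ^ 2 * N v ^ 2)) := by
    have k1 := abs_le.1 (hM u u v v)
    have k2 := abs_le.1 (hM v v u u)
    have k3 := abs_le.1 (hM u v u v)
    have e1 : M * (N u * N u * (N v * N v)) = M * (N u ^ 2 * N v ^ 2) := by ring
    have e2 : M * (N v * N v * (N u * N u)) = M * (N u ^ 2 * N v ^ 2) := by ring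
    have e3 : M * (N u * N v * (N u * N v)) = M * (N u ^ 2 * N v ^ 2) := by ring
    rw [e1] at k1; rw [e2] at k2; rw [e3] at k3
    have := hΛ v
    have := hB0 v
    rw [abs_le, h2]
    constructor <;> linarith [k1.1, k1.2, k2.1, k2.2, k3.1, k3.2]
  have b3 : |f₃| ≤ 4 * (M * (N u * N v ^ 3)) := by
    have k1 := abs_le.1 (hM u v v v)
    have k2 := abs_le.1 (hM v v u v)
    have e1 : M * (N u * N v * (N v * N v)) = M * (N u * N v ^ 3) := by ring
    have e2 : M * (N v * N v * (N u * N v)) = M * (N u * N v ^ 3) := by ring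
    rw [e1] at k1; rw [e2] at k2
    rw [abs_le, h3]
    constructor <;> linarith [k1.1, k1.2, k2.1, k2.2]
  have b4 : |f₄| ≤ M * N v ^ 4 := by
    have k1 := hM v v v v
    rw [h4, abs_neg]
    calc _ ≤ _ := k1
      _ = _ := by ring
  linarith

/-- The distance from a point on a secant of the Nehari manifold to its projection is quadratic
in the length of the secant. -/
theorem exists_quadratic_bound (hP : ∀ x y, P x y = P y x) (hS : 0 < S)
    (hN : ∀ v, N v ≤ S * X v) (hκ : 0 < κ) (hκB : ∀ v, κ * X v ^ 2 ≤ B v v) (hΛ0 : 0 < Λ)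
    (hΛ : ∀ v, B v v ≤ Λ * X v ^ 2) (hM0 : 0 < M)
    (hM : ∀ x y z w, |G (P x y) (P z w)| ≤ M * (N x * N y * (N z * N w)))
    (hc0 : 0 < c) (hc : ∀ v, c * N v ^ 4 ≤ G (P v v) (P v v)) :
    ∃ δ A : ℝ, 0 < δ ∧ 0 < A ∧ ∀ u u' : V, 0 < N u → B u u = G (P u u) (P u u) →
      B u' u' = G (P u' u') (P u' u') → X (u - u') < δ → ∀ t ∈ Icc (0 : ℝ) 1,
        |√(B (u + t • (u - u')) (u + t • (u - u')) /
          G (P (u + t • (u - u')) (u + t • (u - u'))) (P (u + t • (u - u')) (u + t • (u - u')))) -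
            1| * X (u + t • (u - u')) ≤ A * X (u - u') ^ 2 := by
  -- A lower bound for `N` on the manifold: `κ N² ≤ S² κ X² ≤ S² M N⁴`.
  set n₀ : ℝ := √(κ / (M * S ^ 2)) with hn₀
  have hn₀pos : 0 < n₀ := Real.sqrt_pos.2 (by positivity)
  have hn₀sq : n₀ ^ 2 = κ / (M * S ^ 2) := Real.sq_sqrt (by positivity)
  -- This makes `N v ≤ n₀ / 2 ≤ N u / 2`, so that `N` stays above `N u / 2` along the secant.
  set δ : ℝ := n₀ / (2 * S) with hδ
  have hδpos : 0 < δ := by positivity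
  -- Chosen so that the defect is at most `A₁ p² x²`: `p ≥ n₀` absorbs the quadratic term, and `18 =
  -- 12 + 4 + 2` collects the quartic ones.
  set A₁ : ℝ := 2 * Λ / n₀ ^ 2 + 18 * M * S ^ 2 with hA₁
  have hA₁pos : 0 < A₁ := by positivity
  -- Chosen so that `X w ≤ A₂ p²`; the two summands bound `X u` and `X v`.
  set A₂ : ℝ := √(M / κ) + δ / n₀ ^ 2 with hA₂
  have hA₂pos : 0 < A₂ := by positivity
  refine ⟨δ, 16 * A₁ / c * A₂, hδpos, by positivity, fun u u' hp hu hv hx t ht => ?_⟩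
  obtain ⟨v, rfl⟩ : ∃ v, u' = u - v := ⟨u - u', by abel⟩
  rw [sub_sub_cancel] at hx ⊢
  set p := N u
  set q := N v
  set x := X v
  set y := X u
  have hq0 : 0 ≤ q := apply_nonneg N v
  have hx0 : 0 ≤ x := apply_nonneg X v
  have hy0 : 0 ≤ y := apply_nonneg X u
  have hI : κ * y ^ 2 ≤ M * p ^ 4 := by
    calc κ * y ^ 2 ≤ G (P u u) (P u u) := hu ▸ hκB u
      _ ≤ M * (p * p * (p * p)) := (le_abs_self _).trans (hM u u u u)
      _ = M * p ^ 4 := by ring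
  have hpn : n₀ ^ 2 ≤ p ^ 2 := by
    rw [hn₀sq, div_le_iff₀ (by positivity)]
    have h1 : p ^ 2 ≤ S ^ 2 * y ^ 2 := by
      rw [← mul_pow]; exact pow_le_pow_left₀ hp.le (hN u) 2
    have h2 : κ * p ^ 2 ≤ p ^ 2 * (M * S ^ 2) * p ^ 2 := by
      calc κ * p ^ 2 ≤ κ * (S ^ 2 * y ^ 2) := by gcongr
        _ = S ^ 2 * (κ * y ^ 2) := by ring
        _ ≤ S ^ 2 * (M * p ^ 4) := by gcongr
        _ = _ := by ring
    exact le_of_mul_le_mul_right h2 (by positivity)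
  have hn₀p : n₀ ≤ p := le_of_sq_le_sq hpn hp.le
  have hqx : q ≤ S * x := hN v
  have hqp : q ≤ p / 2 := by
    have : S * x ≤ S * δ := mul_le_mul_of_nonneg_left hx.le hS.le
    have e : S * δ = n₀ / 2 := by rw [hδ]; field_simp
    linarith
  have hF := abs_defect_le hP hΛ (fun v => (by positivity : 0 ≤ κ * X v ^ 2).trans (hκB v)) hM
    hu hv ht
  set w := u + t • v with hw
  have htv : N (t • v) ≤ q := by
    rw [map_smul_eq_mul, Real.norm_eq_abs, abs_of_nonneg ht.1]
    exact mul_le_of_le_one_left hq0 ht.2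
  have hNw : p / 2 ≤ N w := by
    have h1 : u = w - t • v := by rw [hw]; abel
    have h2 : p ≤ N w + N (t • v) := by
      calc p = N (w - t • v) := by rw [← h1]
        _ ≤ _ := map_sub_le_add N w (t • v)
    linarith
  have hXw : X w ≤ y + x := by
    refine (map_add_le_add X u (t • v)).trans ?_
    rw [map_smul_eq_mul, Real.norm_eq_abs, abs_of_nonneg ht.1]
    have := mul_le_of_le_one_left hx0 ht.2
    linarith
  have hIw : c * p ^ 4 / 16 ≤ G (P w w) (P w w) := by
    refine le_trans ?_ (hc w)
    have : (p / 2) ^ 4 ≤ N w ^ 4 := pow_le_pow_left₀ (by positivity) hNw 4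
    have := mul_le_mul_of_nonneg_left this hc0.le
    calc c * p ^ 4 / 16 = c * (p / 2) ^ 4 := by ring
      _ ≤ _ := this
  have hIw0 : 0 < G (P w w) (P w w) := lt_of_lt_of_le (by positivity) hIw
  have hF2 : |B w w - G (P w w) (P w w)| ≤ A₁ * (p ^ 2 * x ^ 2) := by
    refine hF.trans ?_
    have hqp' : q ≤ p := by linarith
    have k1 : p * q ^ 3 ≤ p ^ 2 * q ^ 2 := by
      calc p * q ^ 3 = p * q ^ 2 * q := by ring
        _ ≤ p * q ^ 2 * p := by gcongr
        _ = _ := by ring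
    have k2 : q ^ 4 ≤ p ^ 2 * q ^ 2 := by
      calc q ^ 4 = q ^ 2 * q ^ 2 := by ring
        _ ≤ p ^ 2 * q ^ 2 := by gcongr
    have k3 : p ^ 2 * q ^ 2 ≤ S ^ 2 * (p ^ 2 * x ^ 2) := by
      calc p ^ 2 * q ^ 2 ≤ p ^ 2 * (S * x) ^ 2 := by gcongr
        _ = _ := by ring
    have k4 : 2 * Λ * x ^ 2 ≤ 2 * Λ / n₀ ^ 2 * (p ^ 2 * x ^ 2) := by
      rw [div_mul_eq_mul_div, le_div_iff₀ (by positivity)]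
      calc 2 * Λ * x ^ 2 * n₀ ^ 2 ≤ 2 * Λ * x ^ 2 * p ^ 2 := by gcongr
        _ = _ := by ring
    have k5 : M * (12 * (p ^ 2 * q ^ 2) + 4 * (p * q ^ 3) + 2 * q ^ 4) ≤
        18 * M * S ^ 2 * (p ^ 2 * x ^ 2) := by
      calc _ ≤ M * (18 * (S ^ 2 * (p ^ 2 * x ^ 2))) := by gcongr; linarith
        _ = _ := by ring
    rw [hA₁, add_mul]
    exact add_le_add k4 k5
  have hratio : |B w w / G (P w w) (P w w) - 1| ≤ 16 * A₁ / c * (x ^ 2 / p ^ 2) := by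
    rw [div_sub_one hIw0.ne', abs_div, abs_of_pos hIw0, div_le_iff₀ hIw0]
    refine hF2.trans ?_
    calc A₁ * (p ^ 2 * x ^ 2) = 16 * A₁ / c * (x ^ 2 / p ^ 2) * (c * p ^ 4 / 16) := by
          field_simp
      _ ≤ _ := by gcongr
  have hB0 : 0 ≤ B w w := (by positivity : 0 ≤ κ * X w ^ 2).trans (hκB w)
  have hy : y ≤ √(M / κ) * p ^ 2 := by
    rw [← Real.sqrt_sq (show 0 ≤ p ^ 2 by positivity), ← Real.sqrt_mul (by positivity)]
    refine Real.le_sqrt_of_sq_le ?_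
    rw [div_mul_eq_mul_div, le_div_iff₀ hκ]
    calc y ^ 2 * κ = κ * y ^ 2 := mul_comm _ _
      _ ≤ M * p ^ 4 := hI
      _ = _ := by ring
  have hx2 : x ≤ δ / n₀ ^ 2 * p ^ 2 := by
    rw [div_mul_eq_mul_div, le_div_iff₀ (by positivity)]
    gcongr
  have hXw2 : X w ≤ A₂ * p ^ 2 := by rw [hA₂, add_mul]; linarith
  -- The factor `p²` cancels here, which gives uniformity on the unbounded manifold.
  calc _ ≤ (16 * A₁ / c * (x ^ 2 / p ^ 2)) * (A₂ * p ^ 2) := by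
        refine mul_le_mul ((abs_sqrt_sub_one_le (by positivity)).trans hratio) hXw2
          (apply_nonneg X w) (by positivity)
    _ = _ := by field_simp

end Abstract

end Nehari

end

/-! ### `K` and `I` as multilinear forms, and the constants `S`, `κ`, `Λ`, `M`, `c`. -/

noncomputable section

namespace Nehari

variable {d m : ℕ} {Ω : Set (Rn d)}

/-- The embedding `H_0^1(Ω) → L²(Ω)`. -/
def valL (Ω : Set (Rn d)) : H01 Ω →L[ℝ] Lp ℝ 2 (volume.restrict Ω) :=
  (ContinuousLinearMap.fst ℝ _ _).comp (H01 Ω).subtypeL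

/-- The weak gradient as a map `H_0^1(Ω) → L²(Ω, ℝ^d)`. -/
def gradL (Ω : Set (Rn d)) : H01 Ω →L[ℝ] Lp (Rn d) 2 (volume.restrict Ω) :=
  (ContinuousLinearMap.snd ℝ _ _).comp (H01 Ω).subtypeL

theorem valL_apply (u : H01 Ω) : valL Ω u = u.1.1 := rfl

theorem gradL_apply (u : H01 Ω) : gradL Ω u = u.1.2 := rfl

/-- Multiplication by a bounded function on `L²(Ω)`. -/
abbrev mulLinfty {a : Rn d → ℝ} (ha : MemLp a ∞ (volume.restrict Ω)) :
    Lp ℝ 2 (volume.restrict Ω) →L[ℝ] Lp ℝ 2 (volume.restrict Ω) :=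
  (ContinuousLinearMap.mul ℝ ℝ).holderL (volume.restrict Ω) ∞ 2 2 ha.toLp

theorem inner_mulLinfty {a : Rn d → ℝ} (ha : MemLp a ∞ (volume.restrict Ω)) (u : H01 Ω) :
    inner ℝ (mulLinfty ha (valL Ω u)) (valL Ω u) = ∫ x in Ω, a x * val u x ^ 2 := by
  rw [L2.inner_def]
  refine integral_congr_ae ?_
  have h := ContinuousLinearMap.coeFn_holder (r := 2) (ContinuousLinearMap.mul ℝ ℝ) ha.toLp
    (valL Ω u)
  filter_upwards [h, ha.coeFn_toLp] with x h1 h2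
  change inner ℝ ((ContinuousLinearMap.mul ℝ ℝ).holder 2 ha.toLp (valL Ω u) x) _ = _
  rw [h1, ContinuousLinearMap.mul_apply', h2]
  simp only [RCLike.inner_apply, conj_trivial, pow_two]
  change val u x * (a x * val u x) = _
  ring

/-- The bilinear form polarizing `K`. -/
def formK (ε : Fin m → ℝ) {a : Fin m → Rn d → ℝ} (ha : ∀ i, MemLp (a i) ∞ (volume.restrict Ω)) :
    HSpace Ω m →ₗ[ℝ] HSpace Ω m →ₗ[ℝ] ℝ :=
  LinearMap.mk₂ ℝ (fun u v => ∑ i, (ε i * inner ℝ (gradL Ω (u i)) (gradL Ω (v i)) +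
      inner ℝ (mulLinfty (ha i) (valL Ω (u i))) (valL Ω (v i))))
    (fun u u' v => by
      simp only [Pi.add_apply, map_add, inner_add_left, ← Finset.sum_add_distrib]
      exact Finset.sum_congr rfl fun i _ => by ring)
    (fun c u v => by
      simp only [Pi.smul_apply, map_smul, real_inner_smul_left, smul_eq_mul, Finset.mul_sum]
      exact Finset.sum_congr rfl fun i _ => by ring)
    (fun u v v' => by
      simp only [Pi.add_apply, map_add, inner_add_right, ← Finset.sum_add_distrib]
      exact Finset.sum_congr rfl fun i _ => by ring)
    (fun c u v => by
      simp only [Pi.smul_apply, map_smul, real_inner_smul_right, smul_eq_mul, Finset.mul_sum]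
      exact Finset.sum_congr rfl fun i _ => by ring)

theorem formK_apply (ε : Fin m → ℝ) {a : Fin m → Rn d → ℝ}
    (ha : ∀ i, MemLp (a i) ∞ (volume.restrict Ω)) (u v : HSpace Ω m) :
    formK ε ha u v = ∑ i, (ε i * inner ℝ (gradL Ω (u i)) (gradL Ω (v i)) +
      inner ℝ (mulLinfty (ha i) (valL Ω (u i))) (valL Ω (v i))) := rfl

theorem formK_self (ε : Fin m → ℝ) {a : Fin m → Rn d → ℝ}
    (ha : ∀ i, MemLp (a i) ∞ (volume.restrict Ω)) (u : HSpace Ω m) :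
    formK ε ha u u =
      ∑ i, (ε i * ‖(u i).1.2‖ ^ 2 + ∫ x in Ω, a i x * val (u i) x ^ 2) := by
  rw [formK_apply]
  refine Finset.sum_congr rfl fun i _ => ?_
  rw [inner_mulLinfty, real_inner_self_eq_norm_sq, gradL_apply]

theorem K_eq_formK (ε : Fin m → ℝ) {a : Fin m → Rn d → ℝ}
    (ha : ∀ i, MemLp (a i) ∞ (volume.restrict Ω)) (u : HSpace Ω m) :
    K ε a u = formK ε ha u u := by
  have h1 (i : Fin m) : Integrable (fun x => ε i * ‖grad (u i) x‖ ^ 2) (volume.restrict Ω) :=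
    ((memLp_grad (u i)).integrable_norm_pow two_ne_zero).const_mul _
  rw [formK_self, K, integral_finsetSum]
  · refine Finset.sum_congr rfl fun i _ => ?_
    rw [integral_add (h1 i) (integrable_mul_val_sq (ha i) (u i)), integral_const_mul,
      integral_grad_sq]
  · exact fun i _ => (h1 i).add (integrable_mul_val_sq (ha i) (u i))

/-- Together with `differentiable_formG`, this ensures that the `fderiv` in `nehari` is a true
derivative and not the default value `0`. -/
theorem differentiable_formK (ε : Fin m → ℝ) {a : Fin m → Rn d → ℝ}
    (ha : ∀ i, MemLp (a i) ∞ (volume.restrict Ω)) :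
    Differentiable ℝ fun u : HSpace Ω m => formK ε ha u u := by
  simp only [formK_apply]
  refine Differentiable.fun_sum fun i _ => ?_
  have h1 : Differentiable ℝ fun u : HSpace Ω m => gradL Ω (u i) :=
    (gradL Ω).differentiable.comp (differentiable_apply i)
  have h2 : Differentiable ℝ fun u : HSpace Ω m => valL Ω (u i) :=
    (valL Ω).differentiable.comp (differentiable_apply i)
  exact ((h1.inner ℝ h1).const_mul _).add
    (((mulLinfty (ha i)).differentiable.comp h2).inner ℝ h2)

/-- The componentwise product `(u, v) ↦ (uᵢ vᵢ)ᵢ` with values in `L²(Ω, ℝ^m)`. -/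
def prodL2 (m : ℕ) (J : H01 Ω →L[ℝ] Lp ℝ 4 (volume.restrict Ω)) :
    HSpace Ω m →ₗ[ℝ] HSpace Ω m →ₗ[ℝ] (Fin m → Lp ℝ 2 (volume.restrict Ω)) :=
  LinearMap.mk₂ ℝ (fun u v i => mulL4 Ω (J (u i)) (J (v i)))
    (fun u u' v => by ext1 i; simp only [Pi.add_apply, map_add, add_apply])
    (fun c u v => by
      ext1 i; simp only [Pi.smul_apply, map_smul, smul_apply])
    (fun u v v' => by ext1 i; simp only [Pi.add_apply, map_add])
    (fun c u v => by ext1 i; simp only [Pi.smul_apply, map_smul])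

theorem prodL2_apply (J : H01 Ω →L[ℝ] Lp ℝ 4 (volume.restrict Ω)) (u v : HSpace Ω m)
    (i : Fin m) : prodL2 m J u v i = mulL4 Ω (J (u i)) (J (v i)) := rfl

theorem prodL2_comm (J : H01 Ω →L[ℝ] Lp ℝ 4 (volume.restrict Ω)) (u v : HSpace Ω m) :
    prodL2 m J u v = prodL2 m J v u := by
  ext1 i
  rw [prodL2_apply, prodL2_apply]
  refine Lp.ext ?_
  filter_upwards [coeFn_mulL4 (J (u i)) (J (v i)), coeFn_mulL4 (J (v i)) (J (u i))] with x h1 h2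
  rw [h1, h2, mul_comm]

/-- The bilinear form `∑ᵢⱼ gᵢⱼ ⟨xᵢ, yⱼ⟩` on `L²(Ω, ℝ^m)`. -/
def formG (Ω : Set (Rn d)) (g : Matrix (Fin m) (Fin m) ℝ) :
    (Fin m → Lp ℝ 2 (volume.restrict Ω)) →ₗ[ℝ] (Fin m → Lp ℝ 2 (volume.restrict Ω)) →ₗ[ℝ] ℝ :=
  LinearMap.mk₂ ℝ (fun x y => ∑ i, ∑ j, g i j * inner ℝ (x i) (y j))
    (fun u u' v => by
      simp only [Pi.add_apply, inner_add_left, mul_add, Finset.sum_add_distrib])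
    (fun c u v => by
      simp only [Pi.smul_apply, real_inner_smul_left, smul_eq_mul, Finset.mul_sum]
      exact Finset.sum_congr rfl fun i _ => Finset.sum_congr rfl fun j _ => by ring)
    (fun u v v' => by
      simp only [Pi.add_apply, inner_add_right, mul_add, Finset.sum_add_distrib])
    (fun c u v => by
      simp only [Pi.smul_apply, real_inner_smul_right, smul_eq_mul, Finset.mul_sum]
      exact Finset.sum_congr rfl fun i _ => Finset.sum_congr rfl fun j _ => by ring)

theorem formG_apply (g : Matrix (Fin m) (Fin m) ℝ)
    (x y : Fin m → Lp ℝ 2 (volume.restrict Ω)) :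
    formG Ω g x y = ∑ i, ∑ j, g i j * inner ℝ (x i) (y j) := rfl

theorem integrable_mul_mul (r : ℝ) (x y : Lp ℝ 2 (volume.restrict Ω)) :
    Integrable (fun t => r * (x t * y t)) (volume.restrict Ω) :=
  ((Lp.memLp x).integrable_mul (Lp.memLp y)).const_mul r

theorem formG_eq_integral (g : Matrix (Fin m) (Fin m) ℝ)
    (x y : Fin m → Lp ℝ 2 (volume.restrict Ω)) :
    formG Ω g x y = ∫ t in Ω, ∑ i, ∑ j, g i j * (x i t * y j t) := by
  have h (i j : Fin m) := integrable_mul_mul (g i j) (x i) (y j)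
  rw [formG_apply, integral_finsetSum _ fun i _ => integrable_finsetSum _ fun j _ => h i j]
  refine Finset.sum_congr rfl fun i _ => ?_
  rw [integral_finsetSum _ fun j _ => h i j]
  refine Finset.sum_congr rfl fun j _ => ?_
  rw [integral_const_mul, L2.inner_def]
  simp [mul_comm]

theorem I_eq_formG (g : Matrix (Fin m) (Fin m) ℝ)
    {J : H01 Ω →L[ℝ] Lp ℝ 4 (volume.restrict Ω)} (hJ : ∀ u, J u =ᵐ[volume.restrict Ω] val u)
    (u : HSpace Ω m) : I g u = formG Ω g (prodL2 m J u u) (prodL2 m J u u) := by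
  rw [formG_eq_integral, I]
  refine integral_congr_ae ?_
  filter_upwards [ae_all_iff.2 fun i => coeFn_mulL4 (J (u i)) (J (u i)),
    ae_all_iff.2 fun i => hJ (u i)] with x h1 h2
  refine Finset.sum_congr rfl fun i _ => Finset.sum_congr rfl fun j _ => ?_
  rw [prodL2_apply, prodL2_apply, h1, h1, h2, h2]
  ring

theorem differentiable_formG (g : Matrix (Fin m) (Fin m) ℝ)
    (J : H01 Ω →L[ℝ] Lp ℝ 4 (volume.restrict Ω)) :
    Differentiable ℝ fun u : HSpace Ω m => formG Ω g (prodL2 m J u u) (prodL2 m J u u) := by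
  simp only [formG_apply, prodL2_apply]
  have h (i : Fin m) : Differentiable ℝ fun u : HSpace Ω m => mulL4 Ω (J (u i)) (J (u i)) :=
    ((mulL4 Ω).differentiable.clm_apply differentiable_id).comp
      (J.differentiable.comp (differentiable_apply i))
  exact Differentiable.fun_sum fun i _ => Differentiable.fun_sum fun j _ =>
    ((h i).inner ℝ (h j)).const_mul _

/-- `‖·‖_H` as a seminorm. -/
def seminormH (Ω : Set (Rn d)) (ε : Fin m → ℝ) : Seminorm ℝ (HSpace Ω m) :=
  (normSeminorm ℝ (PiLp 2 fun _ : Fin m => Lp (Rn d) 2 (volume.restrict Ω))).comp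
    ((WithLp.linearEquiv 2 ℝ (Fin m → Lp (Rn d) 2 (volume.restrict Ω))).symm.toLinearMap.comp
      (LinearMap.pi fun i => (√(ε i) • (gradL Ω).toLinearMap).comp (LinearMap.proj i)))

theorem seminormH_sq {ε : Fin m → ℝ} (hε : ∀ i, 0 < ε i) (u : HSpace Ω m) :
    seminormH Ω ε u ^ 2 = ∑ i, ε i * ‖(u i).1.2‖ ^ 2 := by
  change ‖(WithLp.toLp 2 (fun i => √(ε i) • gradL Ω (u i)) :
    PiLp 2 fun _ : Fin m => Lp (Rn d) 2 (volume.restrict Ω))‖ ^ 2 = _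
  rw [PiLp.norm_sq_eq_of_L2]
  refine Finset.sum_congr rfl fun i _ => ?_
  change ‖√(ε i) • gradL Ω (u i)‖ ^ 2 = _
  rw [norm_smul, mul_pow, Real.norm_eq_abs, sq_abs, Real.sq_sqrt (hε i).le, gradL_apply]

theorem hNorm_eq_seminormH {ε : Fin m → ℝ} (hε : ∀ i, 0 < ε i) (u : HSpace Ω m) :
    hNorm ε u = seminormH Ω ε u := by
  rw [← Real.sqrt_sq (apply_nonneg (seminormH Ω ε) u), seminormH_sq hε, hNorm,
    integral_finsetSum]
  · congr 1
    refine Finset.sum_congr rfl fun i _ => ?_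
    rw [integral_const_mul, integral_grad_sq]
  · exact fun i _ => ((memLp_grad (u i)).integrable_norm_pow two_ne_zero).const_mul _

/-- The `L⁴`-norm (maximum over the components) as a seminorm. -/
def seminormL4 (m : ℕ) (J : H01 Ω →L[ℝ] Lp ℝ 4 (volume.restrict Ω)) : Seminorm ℝ (HSpace Ω m) :=
  (normSeminorm ℝ (Fin m → Lp ℝ 4 (volume.restrict Ω))).comp
    (LinearMap.pi fun i => J.toLinearMap.comp (LinearMap.proj i))

theorem seminormL4_apply (J : H01 Ω →L[ℝ] Lp ℝ 4 (volume.restrict Ω)) (u : HSpace Ω m) :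
    seminormL4 m J u = ‖fun i => J (u i)‖ := rfl

theorem norm_le_seminormL4 (J : H01 Ω →L[ℝ] Lp ℝ 4 (volume.restrict Ω)) (u : HSpace Ω m)
    (i : Fin m) : ‖J (u i)‖ ≤ seminormL4 m J u :=
  norm_le_pi_norm (fun i => J (u i)) i

/-- The `L⁴`-norm sees only the function component of each pair, so definiteness rests on
`eq_zero_of_val`. -/
theorem seminormL4_pos (hΩo : IsOpen Ω) (hΩb : Bornology.IsBounded Ω)
    {J : H01 Ω →L[ℝ] Lp ℝ 4 (volume.restrict Ω)} (hJ : ∀ u, J u =ᵐ[volume.restrict Ω] val u)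
    {u : HSpace Ω m} (hu : u ≠ 0) : 0 < seminormL4 m J u := by
  refine lt_of_le_of_ne (apply_nonneg _ _) fun h => hu ?_
  ext1 i
  refine eq_zero_of_val hΩo hΩb ?_
  have h0 : J (u i) = 0 := norm_le_zero_iff.1 (h ▸ norm_le_seminormL4 J u i)
  refine (hJ (u i)).symm.trans ?_
  rw [h0]
  exact Lp.coeFn_zero _ _ _

theorem seminormL4_le {J : H01 Ω →L[ℝ] Lp ℝ 4 (volume.restrict Ω)} {C : ℝ} (hC : 0 < C)
    (hJC : ∀ u, ‖J u‖ ≤ C * ‖u.1.2‖) {ε : Fin m → ℝ} (hε : ∀ i, 0 < ε i) :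
    ∃ S : ℝ, 0 < S ∧ ∀ u : HSpace Ω m, seminormL4 m J u ≤ S * seminormH Ω ε u := by
  have hs (i : Fin m) : 0 < √(ε i) := Real.sqrt_pos.2 (hε i)
  have hsum (i : Fin m) : (√(ε i))⁻¹ ≤ 1 + ∑ j, (√(ε j))⁻¹ := by
    have := Finset.single_le_sum (f := fun j => (√(ε j))⁻¹)
      (fun j _ => (inv_pos.2 (hs j)).le) (Finset.mem_univ i)
    linarith
  have hpos : 0 < 1 + ∑ j, (√(ε j))⁻¹ := by
    have := Finset.sum_nonneg (f := fun j => (√(ε j))⁻¹) (s := Finset.univ)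
      (fun j _ => (inv_pos.2 (hs j)).le)
    linarith
  refine ⟨C * (1 + ∑ j, (√(ε j))⁻¹), by positivity, fun u => ?_⟩
  have hX := apply_nonneg (seminormH Ω ε) u
  rw [seminormL4_apply, pi_norm_le_iff_of_nonneg (by positivity)]
  intro i
  refine (hJC (u i)).trans ?_
  rw [mul_assoc]
  refine mul_le_mul_of_nonneg_left ?_ hC.le
  refine le_trans ?_ (mul_le_mul_of_nonneg_right (hsum i) hX)
  rw [← div_eq_inv_mul, le_div_iff₀ (hs i)]
  refine le_of_sq_le_sq ?_ hX
  rw [seminormH_sq hε, mul_pow, Real.sq_sqrt (hε i).le, mul_comm]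
  exact Finset.single_le_sum (f := fun j => ε j * ‖(u j).1.2‖ ^ 2)
    (fun j _ => mul_nonneg (hε j).le (sq_nonneg _)) (Finset.mem_univ i)

theorem exists_formK_ge (hΩb : Bornology.IsBounded Ω)
    {J : H01 Ω →L[ℝ] Lp ℝ 4 (volume.restrict Ω)} (hJ : ∀ u, J u =ᵐ[volume.restrict Ω] val u)
    {C : ℝ} (hC : 0 < C) (hJC : ∀ u, ‖J u‖ ≤ C * ‖u.1.2‖) {ε : Fin m → ℝ} (hε : ∀ i, 0 < ε i)
    {a : Fin m → Rn d → ℝ} (ha : ∀ i, MemLp (a i) ∞ (volume.restrict Ω))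
    (hal : ∀ i, ∀ᵐ x ∂(volume.restrict Ω), -(ε i * lambda1 Ω) < a i x) :
    ∃ κ : ℝ, 0 < κ ∧ ∀ u : HSpace Ω m, κ * seminormH Ω ε u ^ 2 ≤ formK ε ha u u := by
  choose k hk hku using fun i => exists_coercive hΩb hJ hC hJC (hε i) (ha i) (hal i)
  obtain ⟨κ, hκ, hκk⟩ : ∃ κ : ℝ, 0 < κ ∧ ∀ i, κ ≤ k i / ε i := by
    rcases isEmpty_or_nonempty (Fin m) with h | h
    · exact ⟨1, one_pos, fun i => h.elim i⟩
    · obtain ⟨i, hi⟩ := Finite.exists_min fun i => k i / ε i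
      exact ⟨_, div_pos (hk i) (hε i), hi⟩
  refine ⟨κ, hκ, fun u => ?_⟩
  rw [seminormH_sq hε, formK_self, Finset.mul_sum]
  refine Finset.sum_le_sum fun i _ => le_trans ?_ (hku i (u i))
  rw [← mul_assoc]
  exact mul_le_mul_of_nonneg_right ((le_div_iff₀ (hε i)).1 (hκk i)) (sq_nonneg _)

/-- Pairing `u²` with the constant `1` and using the `L⁴` bound gives a Poincaré constant without
knowing that `λ₁ > 0`. -/
theorem exists_norm_val_le (hΩb : Bornology.IsBounded Ω)
    {J : H01 Ω →L[ℝ] Lp ℝ 4 (volume.restrict Ω)} (hJ : ∀ u, J u =ᵐ[volume.restrict Ω] val u)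
    {C : ℝ} (hJC : ∀ u, ‖J u‖ ≤ C * ‖u.1.2‖) :
    ∃ D : ℝ, 0 < D ∧ ∀ u : H01 Ω, ‖u.1.1‖ ^ 2 ≤ D * ‖u.1.2‖ ^ 2 := by
  have hfin : IsFiniteMeasure (volume.restrict Ω) := ⟨by
    rw [Measure.restrict_apply_univ]; exact hΩb.measure_lt_top⟩
  have h1 : MemLp (fun _ : Rn d => (1 : ℝ)) 2 (volume.restrict Ω) := memLp_const 1
  refine ⟨C ^ 2 * ‖h1.toLp‖ + 1, by positivity, fun u => ?_⟩
  have h2 : ‖u.1.1‖ ^ 2 = inner ℝ (mulL4 Ω (J u) (J u)) h1.toLp := by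
    rw [← integral_val_sq, L2.inner_def]
    refine integral_congr_ae ?_
    filter_upwards [h1.coeFn_toLp, coeFn_mulL4 (J u) (J u), hJ u] with x e1 e2 e3
    rw [e1, e2, e3]
    simp [pow_two]
  have h3 : ‖J u‖ ^ 2 ≤ C ^ 2 * ‖u.1.2‖ ^ 2 := by
    rw [← mul_pow]; exact pow_le_pow_left₀ (norm_nonneg _) (hJC u) 2
  rw [h2]
  calc _ ≤ ‖mulL4 Ω (J u) (J u)‖ * ‖h1.toLp‖ := real_inner_le_norm _ _
    _ ≤ C ^ 2 * ‖u.1.2‖ ^ 2 * ‖h1.toLp‖ := by rw [norm_mulL4_self]; gcongr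
    _ ≤ _ := by nlinarith [sq_nonneg ‖u.1.2‖]

theorem exists_formK_le (hΩb : Bornology.IsBounded Ω)
    {J : H01 Ω →L[ℝ] Lp ℝ 4 (volume.restrict Ω)} (hJ : ∀ u, J u =ᵐ[volume.restrict Ω] val u)
    {C : ℝ} (hJC : ∀ u, ‖J u‖ ≤ C * ‖u.1.2‖) {ε : Fin m → ℝ} (hε : ∀ i, 0 < ε i)
    {a : Fin m → Rn d → ℝ} (ha : ∀ i, MemLp (a i) ∞ (volume.restrict Ω)) :
    ∃ Λ : ℝ, 0 < Λ ∧ ∀ u : HSpace Ω m, formK ε ha u u ≤ Λ * seminormH Ω ε u ^ 2 := by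
  obtain ⟨D, hD, hDu⟩ := exists_norm_val_le hΩb hJ hJC
  let k : Fin m → ℝ := fun i => ‖mulLinfty (ha i)‖ * D / ε i
  have hk0 (i : Fin m) : 0 ≤ k i := div_nonneg (mul_nonneg (norm_nonneg _) hD.le) (hε i).le
  have hk (i : Fin m) : k i ≤ ∑ j, k j :=
    Finset.single_le_sum (fun j _ => hk0 j) (Finset.mem_univ i)
  refine ⟨1 + ∑ j, k j, by
    linarith [Finset.sum_nonneg (s := Finset.univ) fun j (_ : j ∈ _) => hk0 j], fun u => ?_⟩
  rw [seminormH_sq hε, formK_self, Finset.mul_sum]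
  refine Finset.sum_le_sum fun i _ => ?_
  have h1 : ∫ x in Ω, a i x * val (u i) x ^ 2 ≤ k i * (ε i * ‖(u i).1.2‖ ^ 2) := by
    rw [← inner_mulLinfty (ha i)]
    calc _ ≤ ‖mulLinfty (ha i) (valL Ω (u i))‖ * ‖valL Ω (u i)‖ := real_inner_le_norm _ _
      _ ≤ ‖mulLinfty (ha i)‖ * ‖valL Ω (u i)‖ * ‖valL Ω (u i)‖ := by
          gcongr; exact ContinuousLinearMap.le_opNorm _ _
      _ = ‖mulLinfty (ha i)‖ * ‖(u i).1.1‖ ^ 2 := by rw [valL_apply]; ring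
      _ ≤ ‖mulLinfty (ha i)‖ * (D * ‖(u i).1.2‖ ^ 2) := by gcongr; exact hDu (u i)
      _ = _ := by simp only [k]; field_simp [(hε i).ne']
  have h2 : 0 ≤ ε i * ‖(u i).1.2‖ ^ 2 := mul_nonneg (hε i).le (sq_nonneg _)
  nlinarith [hk i, mul_le_mul_of_nonneg_right (hk i) h2]

theorem exists_abs_formG_le (g : Matrix (Fin m) (Fin m) ℝ)
    (J : H01 Ω →L[ℝ] Lp ℝ 4 (volume.restrict Ω)) :
    ∃ M : ℝ, 0 < M ∧ ∀ x y z w : HSpace Ω m,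
      |formG Ω g (prodL2 m J x y) (prodL2 m J z w)| ≤
        M * (seminormL4 m J x * seminormL4 m J y * (seminormL4 m J z * seminormL4 m J w)) := by
  refine ⟨1 + ∑ i, ∑ j, |g i j|, by positivity, fun x y z w => ?_⟩
  set R := seminormL4 m J x * seminormL4 m J y * (seminormL4 m J z * seminormL4 m J w)
  have hn (u : HSpace Ω m) : 0 ≤ seminormL4 m J u := apply_nonneg _ _
  have hR : 0 ≤ R := mul_nonneg (mul_nonneg (hn x) (hn y)) (mul_nonneg (hn z) (hn w))
  have hp (u v : HSpace Ω m) (i : Fin m) :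
      ‖prodL2 m J u v i‖ ≤ seminormL4 m J u * seminormL4 m J v :=
    (norm_mulL4_le _ _).trans (mul_le_mul (norm_le_seminormL4 J u i) (norm_le_seminormL4 J v i)
      (norm_nonneg _) (hn u))
  have hi (i j : Fin m) : |g i j * inner ℝ (prodL2 m J x y i) (prodL2 m J z w j)| ≤
      |g i j| * R := by
    rw [abs_mul]
    refine mul_le_mul_of_nonneg_left ((abs_real_inner_le_norm _ _).trans ?_) (abs_nonneg _)
    exact mul_le_mul (hp x y i) (hp z w j) (norm_nonneg _) (mul_nonneg (hn x) (hn y))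
  rw [formG_apply]
  calc _ ≤ ∑ i, ∑ j, |g i j * inner ℝ (prodL2 m J x y i) (prodL2 m J z w j)| :=
        (Finset.abs_sum_le_sum_abs _ _).trans
          (Finset.sum_le_sum fun i _ => Finset.abs_sum_le_sum_abs _ _)
    _ ≤ ∑ i, ∑ j, |g i j| * R := Finset.sum_le_sum fun i _ => Finset.sum_le_sum fun j _ => hi i j
    _ = (∑ i, ∑ j, |g i j|) * R := by simp only [Finset.sum_mul]
    _ ≤ _ := by nlinarith

/-- The quadratic form of `g` is coercive on the nonnegative cone. -/
theorem exists_quadraticForm_ge {g : Matrix (Fin m) (Fin m) ℝ}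
    (hg : (∀ i j, 0 < g i j) ∨ g.PosDef) :
    ∃ c : ℝ, 0 < c ∧ ∀ y : Fin m → ℝ, (∀ i, 0 ≤ y i) →
      c * ∑ i, y i ^ 2 ≤ ∑ i, ∑ j, g i j * (y i * y j) := by
  let q : (Fin m → ℝ) → ℝ := fun y => ∑ i, ∑ j, g i j * (y i * y j)
  -- `q` is positive on this compact part of the sphere, so it has a positive minimum there, and
  -- homogeneity of degree two extends the bound to the cone. The set is empty when `m = 0`.
  let s : Set (Fin m → ℝ) := {y | (∀ i, 0 ≤ y i) ∧ ∑ i, y i ^ 2 = 1}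
  have hq : Continuous q := by fun_prop
  have hpos : ∀ y ∈ s, 0 < q y := by
    rintro y ⟨hy, hy1⟩
    obtain ⟨k, hk⟩ : ∃ k, y k ≠ 0 := by
      by_contra! h
      simp [h] at hy1
    rcases hg with hg | hg
    · have hn (i j : Fin m) : 0 ≤ g i j * (y i * y j) :=
        mul_nonneg (hg i j).le (mul_nonneg (hy i) (hy j))
      have hk' : 0 < y k := lt_of_le_of_ne (hy k) hk.symm
      calc 0 < g k k * (y k * y k) := mul_pos (hg k k) (mul_pos hk' hk')
        _ ≤ ∑ j, g k j * (y k * y j) :=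
          Finset.single_le_sum (f := fun j => g k j * (y k * y j)) (fun j _ => hn k j)
            (Finset.mem_univ k)
        _ ≤ q y := Finset.single_le_sum (f := fun i => ∑ j, g i j * (y i * y j))
            (fun i _ => Finset.sum_nonneg fun j _ => hn i j) (Finset.mem_univ k)
    · have h := hg.dotProduct_mulVec_pos (x := y) (fun h => hk (by rw [h]; rfl))
      have e : star y ⬝ᵥ g.mulVec y = q y := by
        simp only [dotProduct, Matrix.mulVec, q, Finset.mul_sum, star_trivial]
        exact Finset.sum_congr rfl fun i _ => Finset.sum_congr rfl fun j _ => by ring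
      rwa [e] at h
  obtain ⟨c, hc, hcs⟩ : ∃ c : ℝ, 0 < c ∧ ∀ y ∈ s, c ≤ q y := by
    rcases s.eq_empty_or_nonempty with h | h
    · exact ⟨1, one_pos, by simp [h]⟩
    · have hcl : IsClosed s := by
        have h1 : IsClosed {y : Fin m → ℝ | ∀ i, 0 ≤ y i} := by
          simp only [ofPred_forall]
          exact isClosed_iInter fun i => isClosed_le continuous_const (continuous_apply i)
        exact h1.inter (isClosed_eq (by fun_prop) continuous_const)
      have hbd : s ⊆ Icc 0 1 := by
        rintro y ⟨hy, hy1⟩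
        refine ⟨hy, fun i => ?_⟩
        have := Finset.single_le_sum (f := fun i => y i ^ 2) (fun i _ => sq_nonneg _)
          (Finset.mem_univ i)
        simp only [hy1] at this
        exact (sq_le_one_iff₀ (hy i)).1 this
      obtain ⟨y, hy, hmin⟩ := (isCompact_Icc.of_isClosed_subset hcl hbd).exists_isMinOn h
        hq.continuousOn
      exact ⟨q y, hpos y hy, hmin⟩
  refine ⟨c, hc, fun y hy => ?_⟩
  set r := √(∑ i, y i ^ 2) with hr
  have hr2 : r ^ 2 = ∑ i, y i ^ 2 := Real.sq_sqrt (Finset.sum_nonneg fun i _ => sq_nonneg _)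
  rcases eq_or_ne r 0 with h0 | h0
  · rw [← hr2, h0]
    have hz (i : Fin m) : y i = 0 := by
      have := Finset.single_le_sum (f := fun i => y i ^ 2) (fun i _ => sq_nonneg _)
        (Finset.mem_univ i)
      rw [← hr2, h0] at this
      exact pow_eq_zero_iff two_ne_zero |>.1
        (le_antisymm (by simpa using this) (sq_nonneg _))
    simp [hz]
  · have hrpos : 0 < r := lt_of_le_of_ne (Real.sqrt_nonneg _) h0.symm
    have hmem : (fun i => y i / r) ∈ s := by
      refine ⟨fun i => div_nonneg (hy i) hrpos.le, ?_⟩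
      simp only [div_pow, ← Finset.sum_div]
      rw [← hr2, div_self (by positivity)]
    have h1 := hcs _ hmem
    have e : q (fun i => y i / r) = q y / r ^ 2 := by
      simp only [q, Finset.sum_div]
      exact Finset.sum_congr rfl fun i _ => Finset.sum_congr rfl fun j _ => by field_simp
    rw [e, le_div_iff₀ (by positivity), hr2] at h1
    exact h1

/-- The pointwise bound is integrated. Nonnegative `y` suffice, since it is applied to the squares
`uᵢ²`. -/
theorem formG_self_ge {g : Matrix (Fin m) (Fin m) ℝ} {c : ℝ}
    (hc : ∀ y : Fin m → ℝ, (∀ i, 0 ≤ y i) →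
      c * ∑ i, y i ^ 2 ≤ ∑ i, ∑ j, g i j * (y i * y j))
    (y : Fin m → Lp ℝ 2 (volume.restrict Ω))
    (hy : ∀ i, ∀ᵐ t ∂(volume.restrict Ω), 0 ≤ y i t) :
    c * ∑ i, ‖y i‖ ^ 2 ≤ formG Ω g y y := by
  have hi (i : Fin m) : Integrable (fun t => y i t ^ 2) (volume.restrict Ω) :=
    (Lp.memLp (y i)).integrable_sq
  have h : ∑ i, ‖y i‖ ^ 2 = ∫ t in Ω, ∑ i, y i t ^ 2 := by
    rw [integral_finsetSum _ fun i _ => hi i]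
    refine Finset.sum_congr rfl fun i _ => ?_
    rw [← real_inner_self_eq_norm_sq, L2.inner_def]
    simp only [real_inner_self_eq_norm_sq, Real.norm_eq_abs, sq_abs]
  rw [h, formG_eq_integral, ← integral_const_mul]
  refine integral_mono_ae ((integrable_finsetSum _ fun i _ => hi i).const_mul _)
    (integrable_finsetSum _ fun i _ => integrable_finsetSum _ fun j _ =>
      integrable_mul_mul (g i j) (y i) (y j)) ?_
  filter_upwards [ae_all_iff.2 hy] with t ht
  exact hc (fun i => y i t) ht

theorem exists_formG_ge {g : Matrix (Fin m) (Fin m) ℝ} (hg : (∀ i j, 0 < g i j) ∨ g.PosDef)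
    (J : H01 Ω →L[ℝ] Lp ℝ 4 (volume.restrict Ω)) :
    ∃ c : ℝ, 0 < c ∧ ∀ u : HSpace Ω m,
      c * seminormL4 m J u ^ 4 ≤ formG Ω g (prodL2 m J u u) (prodL2 m J u u) := by
  obtain ⟨c, hc, hcy⟩ := exists_quadraticForm_ge hg
  refine ⟨c, hc, fun u => ?_⟩
  -- The seminorm is a maximum over components, so the largest component alone accounts for the
  -- left-hand side.
  have h1 : seminormL4 m J u ^ 4 ≤ ∑ i, ‖prodL2 m J u u i‖ ^ 2 := by
    rcases isEmpty_or_nonempty (Fin m) with h | h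
    · have h0 : seminormL4 m J u ≤ 0 := by
        rw [seminormL4_apply, pi_norm_le_iff_of_nonneg le_rfl]
        exact fun i => h.elim i
      rw [le_antisymm h0 (apply_nonneg _ _), zero_pow four_ne_zero]
      exact Finset.sum_nonneg fun i _ => sq_nonneg _
    · obtain ⟨i, hi⟩ := Finite.exists_max fun i => ‖J (u i)‖
      have h2 : seminormL4 m J u ≤ ‖J (u i)‖ := by
        rw [seminormL4_apply, pi_norm_le_iff_of_nonneg (norm_nonneg _)]
        exact hi
      calc _ ≤ ‖J (u i)‖ ^ 4 := pow_le_pow_left₀ (apply_nonneg _ _) h2 4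
        _ = ‖prodL2 m J u u i‖ ^ 2 := by rw [prodL2_apply, norm_mulL4_self]; ring
        _ ≤ _ := Finset.single_le_sum (f := fun i => ‖prodL2 m J u u i‖ ^ 2)
            (fun i _ => sq_nonneg _) (Finset.mem_univ i)
  refine (mul_le_mul_of_nonneg_left h1 hc.le).trans (formG_self_ge hcy _ fun i => ?_)
  filter_upwards [coeFn_mulL4 (J (u i)) (J (u i))] with t ht
  rw [prodL2_apply, ht]
  exact mul_self_nonneg _

end Nehari

end

/-! ### The Nehari condition as `K = I`, projection along rays, and the conclusion. -/

noncomputable section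

namespace Nehari

/-- The derivative along the ray through `v` of a functional that is a combination of a quadratic
and a quartic homogeneous part. -/
theorem fderiv_self_eq {V : Type*} [NormedAddCommGroup V] [NormedSpace ℝ V] {k l : V → ℝ}
    (hk : Differentiable ℝ k) (hl : Differentiable ℝ l)
    (hks : ∀ (s : ℝ) v, k (s • v) = s ^ 2 * k v) (hls : ∀ (s : ℝ) v, l (s • v) = s ^ 4 * l v)
    (v : V) : fderiv ℝ (fun v => 1 / 2 * k v - 1 / 4 * l v) v v = k v - l v := by
  set F : V → ℝ := fun v => 1 / 2 * k v - 1 / 4 * l v with hF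
  have hFd : Differentiable ℝ F := (hk.const_mul _).sub (hl.const_mul _)
  -- Euler's identity: `s ↦ F (s • v)` is differentiated at `s = 1` by the chain rule and from its
  -- explicit form.
  have h1 : HasDerivAt (fun s : ℝ => s • v) v 1 := by
    simpa using (hasDerivAt_id (1 : ℝ)).smul_const v
  have h2 : HasDerivAt (fun s : ℝ => F (s • v)) (fderiv ℝ F v v) 1 := by
    have hF' : HasFDerivAt F (fderiv ℝ F v) ((1 : ℝ) • v) := by
      rw [one_smul]; exact (hFd v).hasFDerivAt
    exact hF'.comp_hasDerivAt 1 h1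
  have h3 : HasDerivAt (fun s : ℝ => F (s • v)) (k v - l v) 1 := by
    simp only [hF, hks, hls]
    have := ((((hasDerivAt_id (1 : ℝ)).pow 2).mul_const (k v)).const_mul (1 / 2)).sub
      ((((hasDerivAt_id (1 : ℝ)).pow 4).mul_const (l v)).const_mul (1 / 4))
    convert! this using 1
    simp
  exact h2.unique h3

section Abstract

variable {V W : Type*} [AddCommGroup V] [Module ℝ V] [AddCommGroup W] [Module ℝ W]
  (B : V →ₗ[ℝ] V →ₗ[ℝ] ℝ) (P : V →ₗ[ℝ] V →ₗ[ℝ] W) (G : W →ₗ[ℝ] W →ₗ[ℝ] ℝ)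

theorem quadratic_smul (s : ℝ) (v : V) : B (s • v) (s • v) = s ^ 2 * B v v := by
  simp only [map_smul, LinearMap.smul_apply, smul_eq_mul]; ring

theorem quartic_smul (s : ℝ) (v : V) :
    G (P (s • v) (s • v)) (P (s • v) (s • v)) = s ^ 4 * G (P v v) (P v v) := by
  simp only [map_smul, LinearMap.smul_apply, smul_eq_mul]; ring

variable {B P G}

theorem seminorm_smul_sub_self (X : Seminorm ℝ V) (r : ℝ) (v : V) :
    X (r • v - v) = |r - 1| * X v := by
  have h : r • v - v = (r - 1) • v := by rw [sub_smul, one_smul]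
  rw [h, map_smul_eq_mul, Real.norm_eq_abs]

/-- If it vanished, `t v = (1 + t) u` would put both points on one ray. Comparing the degrees two
and four, where `B` and the quartic form agree at `u` and at `v`, would force `(1 + t)² = t²`. -/
theorem secant_ne_zero (hB : ∀ v, v ≠ 0 → 0 < B v v) {u v : V} (hu0 : u ≠ 0)
    (hu : B u u = G (P u u) (P u u)) (hv : B v v = G (P v v) (P v v)) {t : ℝ} (ht : 0 ≤ t) :
    u + t • (u - v) ≠ 0 := by
  intro h0
  have h1 : t • v = (1 + t) • u := by
    have : t • v = (1 + t) • u - (u + t • (u - v)) := by module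
    rw [this, h0, sub_zero]
  have k1 := congrArg (fun v => B v v) h1
  have k2 := congrArg (fun v => G (P v v) (P v v)) h1
  simp only [quadratic_smul, quartic_smul] at k1 k2
  rw [← hu, ← hv] at k2
  have hpos := hB u hu0
  have e : (1 + t) ^ 2 * B u u * ((1 + t) ^ 2 - t ^ 2) = 0 := by
    linear_combination t ^ 2 * k1 - k2
  have p1 : 0 < (1 + t) ^ 2 - t ^ 2 := by nlinarith
  have p2 : 0 < 1 + t := by linarith
  exact absurd e (by positivity)

/-- The scaling that maps `v` onto the Nehari manifold. -/
theorem nehari_identity_smul {v : V} (hB : 0 < B v v) (hG : 0 < G (P v v) (P v v)) {r : ℝ}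
    (hr : r = √(B v v / G (P v v) (P v v))) :
    B (r • v) (r • v) = G (P (r • v) (r • v)) (P (r • v) (r • v)) := by
  have hr2 : r ^ 2 = B v v / G (P v v) (P v v) := by rw [hr, Real.sq_sqrt (by positivity)]
  rw [quadratic_smul, quartic_smul, show r ^ 4 = (r ^ 2) ^ 2 by ring, hr2]
  field_simp

end Abstract

section Functional

variable {d m : ℕ} {Ω : Set (Rn d)} {ε : Fin m → ℝ} {a : Fin m → Rn d → ℝ}
  {g : Matrix (Fin m) (Fin m) ℝ} {J : H01 Ω →L[ℝ] Lp ℝ 4 (volume.restrict Ω)}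

theorem fderiv_E_self (ha : ∀ i, MemLp (a i) ∞ (volume.restrict Ω))
    (hJ : ∀ u, J u =ᵐ[volume.restrict Ω] val u) (v : HSpace Ω m) :
    fderiv ℝ (E ε a g) v v =
      formK ε ha v v - formG Ω g (prodL2 m J v v) (prodL2 m J v v) := by
  have hE : E ε a g = fun v : HSpace Ω m => 1 / 2 * formK ε ha v v -
      1 / 4 * formG Ω g (prodL2 m J v v) (prodL2 m J v v) :=
    funext fun v => congrArg₂ (fun x y : ℝ => 1 / 2 * x - 1 / 4 * y) (K_eq_formK ε ha v)
      (I_eq_formG g hJ v)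
  rw [hE]
  exact fderiv_self_eq (V := HSpace Ω m) (k := fun v => formK ε ha v v)
    (l := fun v => formG Ω g (prodL2 m J v v) (prodL2 m J v v))
    (differentiable_formK ε ha) (differentiable_formG g J)
    (fun s v => by simp only [map_smul, LinearMap.smul_apply, smul_eq_mul]; ring)
    (fun s v => by simp only [map_smul, LinearMap.smul_apply, smul_eq_mul]; ring) v

theorem mem_nehari_iff (ha : ∀ i, MemLp (a i) ∞ (volume.restrict Ω))
    (hJ : ∀ u, J u =ᵐ[volume.restrict Ω] val u) (v : HSpace Ω m) :
    v ∈ nehari Ω ε a g ↔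
      v ≠ 0 ∧ formK ε ha v v = formG Ω g (prodL2 m J v v) (prodL2 m J v v) := by
  change _ ∧ _ ↔ _
  rw [fderiv_E_self ha hJ, sub_eq_zero]

theorem rho_eq (ha : ∀ i, MemLp (a i) ∞ (volume.restrict Ω))
    (hJ : ∀ u, J u =ᵐ[volume.restrict Ω] val u) (v : HSpace Ω m) :
    rho ε a g v =
      √(formK ε ha v v / formG Ω g (prodL2 m J v v) (prodL2 m J v v)) := by
  rw [rho, K_eq_formK ε ha, I_eq_formG g hJ]

theorem hNorm_smul_sub_self (hε : ∀ i, 0 < ε i) (r : ℝ) (v : HSpace Ω m) :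
    hNorm ε (r • v - v) = |r - 1| * seminormH Ω ε v := by
  rw [hNorm_eq_seminormH hε]
  exact seminorm_smul_sub_self _ r v

theorem hDist_le (hε : ∀ i, 0 < ε i) {S : Set (HSpace Ω m)} {w : HSpace Ω m} (hw : w ∈ S)
    (v : HSpace Ω m) : hDist ε v S ≤ hNorm ε (w - v) := by
  refine csInf_le ⟨0, ?_⟩ ⟨w, hw, ?_⟩
  · rintro r ⟨s, -, rfl⟩
    exact Real.sqrt_nonneg _
  · change hNorm ε (v - w) = _
    rw [hNorm_eq_seminormH hε, hNorm_eq_seminormH hε]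
    exact map_sub_rev (seminormH Ω ε) v w

end Functional

end Nehari

end

theorem lemma3p1 {d m : ℕ} (hd1 : 1 ≤ d) (hd4 : d ≤ 4)
    (Ω : Set (EuclideanSpace ℝ (Fin d))) (hΩo : IsOpen Ω) (hΩc : IsConnected Ω)
    (hΩb : Bornology.IsBounded Ω)
    (ε : Fin m → ℝ) (hε : ∀ i, 0 < ε i)
    (g : Matrix (Fin m) (Fin m) ℝ) (hgs : g.IsSymm)
    (hg : (∀ i j, 0 < g i j) ∨ g.PosDef)
    (a : Fin m → EuclideanSpace ℝ (Fin d) → ℝ)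
    (ha : ∀ i, MemLp (a i) ∞ (volume.restrict Ω))
    (hal : ∀ i, ∀ᵐ x ∂(volume.restrict Ω), -(ε i * Nehari.lambda1 Ω) < a i x) :
    (∀ u ∈ Nehari.nehari Ω ε a g, ∀ ubar ∈ Nehari.nehari Ω ε a g, ∀ t ∈ Set.Icc (0 : ℝ) 1,
      ∀ what w : Nehari.HSpace Ω m,
      what = u + t • (u - ubar) → w = Nehari.rho ε a g what • what →
        what ≠ 0 ∧ w ∈ Nehari.nehari Ω ε a g ∧
        Nehari.hDist ε what (Nehari.nehari Ω ε a g) ≤ Nehari.hNorm ε (w - what)) ∧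
    (∀ η : ℝ, 0 < η → ∃ δ : ℝ, 0 < δ ∧
      ∀ u ∈ Nehari.nehari Ω ε a g, ∀ ubar ∈ Nehari.nehari Ω ε a g, ∀ t ∈ Set.Icc (0 : ℝ) 1,
      ∀ what w : Nehari.HSpace Ω m,
      what = u + t • (u - ubar) → w = Nehari.rho ε a g what • what →
        Nehari.hNorm ε (u - ubar) < δ →
          Nehari.hNorm ε (w - what) ≤ η * Nehari.hNorm ε (u - ubar)) := by
  obtain ⟨J, C, hC, hJ, hJC⟩ := Nehari.exists_toL4 hd1 hd4 hΩb
  obtain ⟨S, hS, hN⟩ := Nehari.seminormL4_le hC hJC hε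
  obtain ⟨κ, hκ, hκB⟩ := Nehari.exists_formK_ge hΩb hJ hC hJC hε ha hal
  obtain ⟨Λ, hΛ0, hΛ⟩ := Nehari.exists_formK_le hΩb hJ hJC hε ha
  obtain ⟨M, hM0, hM⟩ := Nehari.exists_abs_formG_le g J
  obtain ⟨c, hc0, hc⟩ := Nehari.exists_formG_ge hg J
  have hmem := Nehari.mem_nehari_iff (ε := ε) (g := g) ha hJ
  have hrho := Nehari.rho_eq (ε := ε) (g := g) ha hJ
  have hNpos (v) (hv : v ≠ 0) := Nehari.seminormL4_pos (m := m) (u := v) hΩo hΩb hJ hv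
  have hGpos (v) (hv : v ≠ 0) :
      0 < Nehari.formG Ω g (Nehari.prodL2 m J v v) (Nehari.prodL2 m J v v) :=
    lt_of_lt_of_le (mul_pos hc0 (pow_pos (hNpos v hv) 4)) (hc v)
  -- `0 < N v ≤ S X v` forces `X v > 0`, so the seminorm `X` is definite as well.
  have hBpos (v) (hv : v ≠ 0) : 0 < Nehari.formK ε ha v v :=
    lt_of_lt_of_le (mul_pos hκ (pow_pos (pos_of_mul_pos_right
      ((hNpos v hv).trans_le (hN v)) hS.le) 2)) (hκB v)
  refine ⟨?_, ?_⟩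
  · rintro u hu ubar hubar t ht what w rfl rfl
    have hu' := (hmem u).1 hu
    have hubar' := (hmem ubar).1 hubar
    have hne := Nehari.secant_ne_zero hBpos hu'.1 hu'.2 hubar'.2 ht.1
    generalize u + t • (u - ubar) = v at hne ⊢
    have hr : 0 < Nehari.rho ε a g v := by
      rw [hrho]
      exact Real.sqrt_pos.2 (div_pos (hBpos v hne) (hGpos v hne))
    have hw : Nehari.rho ε a g v • v ∈ Nehari.nehari Ω ε a g :=
      (hmem _).2 ⟨smul_ne_zero hr.ne' hne,
        Nehari.nehari_identity_smul (hBpos v hne) (hGpos v hne) (hrho v)⟩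
    exact ⟨hne, hw, Nehari.hDist_le hε hw v⟩
  · obtain ⟨δ, A, hδ, hA, hbound⟩ := Nehari.exists_quadratic_bound
      (Nehari.prodL2_comm J) hS hN hκ hκB hΛ0 hΛ hM0 hM hc0 hc
    intro η hη
    -- The second entry turns the quadratic bound `A x²` into `η x`.
    refine ⟨min δ (η / A), lt_min hδ (div_pos hη hA), ?_⟩
    rintro u hu ubar hubar t ht what w rfl rfl hlt
    have hu' := (hmem u).1 hu
    have hubar' := (hmem ubar).1 hubar
    rw [Nehari.hNorm_eq_seminormH hε] at hlt
    rw [Nehari.hNorm_smul_sub_self hε, Nehari.hNorm_eq_seminormH hε, hrho]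
    have h := hbound u ubar (hNpos u hu'.1) hu'.2 hubar'.2 (hlt.trans_le (min_le_left _ _)) t ht
    refine h.trans ?_
    have h1 : A * Nehari.seminormH Ω ε (u - ubar) ≤ η := by
      rw [mul_comm, ← le_div_iff₀ hA]
      exact hlt.le.trans (min_le_right _ _)
    rw [pow_two, ← mul_assoc]
    exact mul_le_mul_of_nonneg_right h1 (apply_nonneg _ _)
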